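/- Let $\{\xi;\,d(\xi,\xi')\}$ be a random structure in the plane such that: (A1) the points $\Xi=\{\xi\}$ form a Poisson process of intensity one on $\mathbb{R}^2$; (A2) on each realization, there are non-negative finite route-lengths $d(\xi,\xi')=d(\xi',\xi)$, for $\xi,\xi'\in\Xi$, satisfying the triangle inequality (nothing else is assumed about $d$); (A3) the distribution of the whole structure $\{\xi;\,d(\xi,\xi')\}$ is invariant under all translations $T_{a,b}(x,y)=(x+a,y+b)$ of the plane, and for each $(a,b)\neq(0,0)$ the translation $T_{a,b}$ acts ergodically on it. For $z\in\mathbb{R}^2$ write $(r_z,\theta_z)$ for its polar coordinates and $z+B=\{z+z':z'\in B\}$. Assume the $L^2$ bound: for all bounded Borel sets $A,B\subset\mathbb{R}^2$, $$\sup_{z\in\mathbb{R}^2}\frac{E\sum_{\xi\in A}\sum_{\xi'\in z+B}d^2(\xi,\xi')}{\max(1,r_z^2)}<\infty .$$ Then the $L^1$ shape property holds: there are constants $\rho(\theta)\in[0,\infty)$, depending only on the angle $\theta$ (that is, $\rho$ is a $2\pi$-periodic function on $\mathbb{R}$), such that for all bounded Borel sets $A,B\subset\mathbb{R}^2$, $$r_z^{-1}\,E\sum_{\xi\in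 A}\sum_{\xi'\in z+B}\bigl|d(\xi,\xi')-r_z\,\rho(\theta_z)\bigr|\;\to\;0\qquad\text{as } r_z\to\infty$$ (uniformly in the direction of $z$). Moreover $\rho$ is Lipschitz: $$\sup_{\theta_1\neq\theta_2}\frac{|\rho(\theta_2)-\rho(\theta_1)|}{|\theta_2-\theta_1|}<\infty .$$ -/

import Mathlib

open MeasureTheory ProbabilityTheory Filter Topology
open scoped NNReal ENNReal Pointwise

noncomputable section

/-- The Euclidean plane `ℝ²`. -/
abbrev Plane : Type := EuclideanSpace ℝ (Fin 2)

/-- The angular coordinate `θ_z ∈ (-π, π]` of a point `z` of the plane (the radial one is `‖z‖`). -/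
def polarAngle (z : Plane) : ℝ := Complex.arg ⟨z 0, z 1⟩

/-- One realization of the structure `{ξ; d(ξ, ξ')}`: a locally finite set of points of the plane
with non-negative, finite, symmetric route-lengths satisfying the triangle inequality. Neither
`d ξ ξ = 0` nor any comparison with Euclidean distance is required. -/
structure RouteSystem where
  /-- the points `ξ` -/
  points : Set Plane
  locallyFinite : ∀ A : Set Plane, Bornology.IsBounded A → (points ∩ A).Finite
  /-- the route-length between two of the points -/
  d : points → points → ℝ
  d_nonneg : ∀ x y, 0 ≤ d x y
  d_symm : ∀ x y, d x y = d y x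
  d_triangle : ∀ x y z, d x z ≤ d x y + d y z

namespace RouteSystem

/-- The counting measure `∑_{ξ, ξ'} δ_{(ξ, ξ', d(ξ, ξ'))}` which encodes the whole structure. -/
def toMeasure (N : RouteSystem) : Measure (Plane × Plane × ℝ) :=
  Measure.sum fun p : N.points × N.points =>
    Measure.dirac ((p.1 : Plane), (p.2 : Plane), N.d p.1 p.2)

/-- The usual σ-algebra on realizations: it is generated by the numbers of pairs `(ξ, ξ')` such that
`(ξ, ξ', d(ξ, ξ'))` lies in a given Borel set. -/
instance : MeasurableSpace RouteSystem :=
  MeasurableSpace.comap toMeasure inferInstance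

/-- Translation of the whole structure by the vector `v`. -/
def translate (v : Plane) (N : RouteSystem) : RouteSystem where
  points := {x | x - v ∈ N.points}
  locallyFinite := by
    intro A hA
    have h : ((fun x : Plane => x - v) '' A) = (-v) +ᵥ A :=
      Set.image_congr fun x _ => sub_eq_neg_add x v
    have hb : Bornology.IsBounded ((fun x : Plane => x - v) '' A) := by
      rw [h]
      exact hA.vadd (-v)
    refine Set.Finite.of_finite_image
      ((N.locallyFinite _ hb).subset ?_) (f := fun x : Plane => x - v)
      (fun x _ y _ hxy => sub_left_injective hxy)
    rintro _ ⟨x, ⟨hx, hxA⟩, rfl⟩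
    exact ⟨hx, x, hxA, rfl⟩
  d x y := N.d ⟨(x : Plane) - v, x.2⟩ ⟨(y : Plane) - v, y.2⟩
  d_nonneg _ _ := N.d_nonneg _ _
  d_symm _ _ := N.d_symm _ _
  d_triangle _ _ _ := N.d_triangle _ _ _

/-- `N(A)`, the number of points in the (bounded) set `A`. -/
def count (N : RouteSystem) (A : Set Plane) : ℕ := (N.points ∩ A).ncard

/-- `∑_{ξ ∈ A} ∑_{ξ' ∈ B} f(d(ξ, ξ'))`. -/
def pairSum (N : RouteSystem) (A B : Set Plane) (f : ℝ → ℝ≥0∞) : ℝ≥0∞ :=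
  ∑' x : {x : N.points // (x : Plane) ∈ A}, ∑' y : {y : N.points // (y : Plane) ∈ B},
    f (N.d x.1 y.1)

/-- `S(A, B; c) = ∑_{ξ ∈ A} ∑_{ξ' ∈ B} |d(ξ, ξ') - c|`. -/
def S (N : RouteSystem) (A B : Set Plane) (c : ℝ) : ℝ≥0∞ :=
  N.pairSum A B fun t => ENNReal.ofReal |t - c|

end RouteSystem

/-- The points of the random structure `X` form a Poisson process of intensity one on `ℝ²`. -/
structure IsRateOnePoisson {Ω : Type*} [MeasurableSpace Ω] (P : Measure Ω)
    (X : Ω → RouteSystem) : Prop where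
  law : ∀ A : Set Plane, MeasurableSet A → Bornology.IsBounded A →
    P.map (fun ω => (X ω).count A) = poissonMeasure (volume A).toNNReal
  indep : ∀ (n : ℕ) (A : Fin n → Set Plane), (∀ i, MeasurableSet (A i)) →
    (∀ i, Bornology.IsBounded (A i)) → Pairwise (fun i j => Disjoint (A i) (A j)) →
    iIndepFun (fun i ω => (X ω).count (A i)) P

/-- The distribution of the whole structure is translation-invariant, and each non-zero translation
acts ergodically. -/
structure IsInvariantErgodic {Ω : Type*} [MeasurableSpace Ω] (P : Measure Ω)
    (X : Ω → RouteSystem) : Prop where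
  invariant : ∀ v : Plane,
    MeasurePreserving (RouteSystem.translate v) (P.map X) (P.map X)
  ergodic : ∀ v : Plane, v ≠ 0 → Ergodic (RouteSystem.translate v) (P.map X)

/-- The `L²` bound: for all bounded (Borel) `A`, `B`,
`sup_z E ∑_{ξ ∈ A} ∑_{ξ' ∈ z + B} d(ξ, ξ')² / max(1, r_z²) < ∞`. -/
def L2GrowthBound {Ω : Type*} [MeasurableSpace Ω] (P : Measure Ω)
    (X : Ω → RouteSystem) : Prop :=
  ∀ A B : Set Plane, MeasurableSet A → MeasurableSet B →
    Bornology.IsBounded A → Bornology.IsBounded B →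
    (⨆ z : Plane, (∫⁻ ω, (X ω).pairSum A (z +ᵥ B) (fun t => ENNReal.ofReal (t ^ 2)) ∂P) /
      ENNReal.ofReal (max 1 (‖z‖ ^ 2))) < ∞

/-- The `L¹` shape property with constants `ρ(θ)`: for all bounded (Borel) `A`, `B`,
`r_z⁻¹ E S(A, z + B; r_z ρ(θ_z)) → 0` as `r_z → ∞`. -/
def HasL1Shape {Ω : Type*} [MeasurableSpace Ω] (P : Measure Ω)
    (X : Ω → RouteSystem) (ρ : ℝ → ℝ) : Prop :=
  ∀ A B : Set Plane, MeasurableSet A → MeasurableSet B →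
    Bornology.IsBounded A → Bornology.IsBounded B →
    Tendsto (fun z : Plane =>
        (∫⁻ ω, (X ω).S A (z +ᵥ B) (‖z‖ * ρ (polarAngle z)) ∂P) / ENNReal.ofReal ‖z‖)
      (Bornology.cobounded Plane) (𝓝 0)

end

/-! Route-lengths live only between random points, so each `z` of the plane is first given
representatives: the points in the first occupied unit cell to the right of `z` (`marker`). The
process `markerDist z w`, the largest route-length between the representatives of `z` and those of
`w`, is translation covariant, symmetric, and satisfies the triangle inequality as soon as the
middle marker contains a point, hence almost surely. Exponentially small void probabilities, played
against the `L²` bound, give it a mean of at most linear growth (`exists_lintegral_markerDist_le`).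

Such a process has a growth rate in every direction by Fekete's lemma, Lipschitz in the direction
because a detour costs at most linearly. Since the rate is an infimum, the mean never lies below its
linear prediction; thus `L¹` convergence along a ray needs only an upper bound, obtained by cutting
the ray into long blocks and applying the mean ergodic theorem to the block sums
(`tendsto_integral_abs_sub_div`). A finite net of the unit sphere and the Lipschitz bound make this
uniform in the direction (`exists_forall_integral_abs_sub_le`).

For points of `A` and `z + B`, the route-length differs from `markerDist 0 z` by at most the
distances from `A` to the marker of `0` and from the marker of `z` to `z + B`. By stationarity these
are tight, so they are small compared with `‖z‖` off an event whose probability tends to zero; on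
that event the `L²` bound and the second moment of the number of pairs control the sum
(`tendsto_lintegral_S_div`). -/

/-! ### The mean ergodic theorem in `L¹`. -/

theorem integrable_birkhoffAverage_and_integral_abs_le {α : Type*} [MeasurableSpace α] {μ : Measure α}
    {T : α → α} (hT : MeasurePreserving T μ μ) {f : α → ℝ} (hf : Integrable f μ) (n : ℕ) :
    Integrable (birkhoffAverage ℝ T f n) μ ∧
      ∫ x, |birkhoffAverage ℝ T f n x| ∂μ ≤ ∫ x, |f x| ∂μ := by
  have hi : ∀ i, Integrable (fun x => f (T^[i] x)) μ := fun i =>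
    (hT.iterate i).integrable_comp_of_integrable hf
  have hint : Integrable (birkhoffAverage ℝ T f n) μ := by
    have : birkhoffAverage ℝ T f n =
        fun x => (n : ℝ)⁻¹ * ∑ i ∈ Finset.range n, f (T^[i] x) := by
      ext x; simp [birkhoffAverage, birkhoffSum]
    rw [this]
    exact (integrable_finsetSum _ fun i _ => hi i).const_mul _
  refine ⟨hint, ?_⟩
  have hle : ∀ x, |birkhoffAverage ℝ T f n x| ≤
      (n : ℝ)⁻¹ * ∑ i ∈ Finset.range n, |f (T^[i] x)| := by
    intro x
    simp only [birkhoffAverage, birkhoffSum, smul_eq_mul, abs_mul, abs_inv, Nat.abs_cast]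
    gcongr
    exact Finset.abs_sum_le_sum_abs _ _
  calc ∫ x, |birkhoffAverage ℝ T f n x| ∂μ
      ≤ ∫ x, (n : ℝ)⁻¹ * ∑ i ∈ Finset.range n, |f (T^[i] x)| ∂μ :=
        integral_mono hint.abs
          ((integrable_finsetSum _ fun i _ => (hi i).abs).const_mul _) hle
    _ = (n : ℝ)⁻¹ * ∑ i ∈ Finset.range n, ∫ x, |f x| ∂μ := by
        rw [integral_const_mul, integral_finsetSum _ fun i _ => (hi i).abs]
        congr 1
        refine Finset.sum_congr rfl fun i _ => ?_
        have := integral_map (μ := μ) (φ := T^[i]) (f := fun x => |f x|)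
          (hT.iterate i).measurable.aemeasurable
          (by rw [(hT.iterate i).map_eq]; exact hf.abs.aestronglyMeasurable)
        rw [(hT.iterate i).map_eq] at this
        exact this.symm
    _ ≤ ∫ x, |f x| ∂μ := by
        rcases Nat.eq_zero_or_pos n with rfl | h
        · simpa using integral_nonneg fun x => abs_nonneg (f x)
        · simp [h.ne']

theorem integral_birkhoffAverage {α : Type*} [MeasurableSpace α] {μ : Measure α}
    {T : α → α} (hT : MeasurePreserving T μ μ) {f : α → ℝ} (hf : Integrable f μ) {n : ℕ}
    (hn : n ≠ 0) : ∫ x, birkhoffAverage ℝ T f n x ∂μ = ∫ x, f x ∂μ := by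
  have hi : ∀ i, Integrable (fun x => f (T^[i] x)) μ := fun i =>
    (hT.iterate i).integrable_comp_of_integrable hf
  simp only [birkhoffAverage, birkhoffSum, smul_eq_mul]
  rw [integral_const_mul, integral_finsetSum _ fun i _ => hi i]
  have : ∀ i, ∫ x, f (T^[i] x) ∂μ = ∫ x, f x ∂μ := by
    intro i
    have := integral_map (μ := μ) (φ := T^[i]) (f := f)
      (hT.iterate i).measurable.aemeasurable
      (by rw [(hT.iterate i).map_eq]; exact hf.aestronglyMeasurable)
    rw [(hT.iterate i).map_eq] at this
    exact this.symm
  simp [this, hn]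

/-- Lets von Neumann's theorem, which concerns the Koopman operator on `L²` classes, speak about
pointwise averages. -/
theorem toLp_birkhoffAverage {α : Type*} [MeasurableSpace α] {μ : Measure α}
    {T : α → α} (hT : MeasurePreserving T μ μ) {f : α → ℝ} (hf : MemLp f 2 μ) (n : ℕ) :
    (birkhoffAverage ℝ (Lp.compMeasurePreserving T hT) id n (hf.toLp f) : Lp ℝ 2 μ) =ᵐ[μ]
      birkhoffAverage ℝ T f n := by
  have h : ∀ n : ℕ, (∑ i ∈ Finset.range n,
      (Lp.compMeasurePreserving T hT)^[i] (hf.toLp f) : Lp ℝ 2 μ) =ᵐ[μ]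
      fun x => ∑ i ∈ Finset.range n, f (T^[i] x) := by
    intro n
    induction n with
    | zero =>
      simp only [Finset.range_zero, Finset.sum_empty]
      exact Lp.coeFn_zero ℝ 2 μ
    | succ n ih =>
      rw [Finset.sum_range_succ]
      refine (Lp.coeFn_add _ _).trans ?_
      have h2 : (((Lp.compMeasurePreserving T hT)^[n] (hf.toLp f) : Lp ℝ 2 μ) : α → ℝ) =ᵐ[μ]
          fun x => f (T^[n] x) := by
        rw [Lp.compMeasurePreserving_iterate, Lp.toLp_compMeasurePreserving]
        exact MemLp.coeFn_toLp _
      filter_upwards [ih, h2] with x h1 h2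
      rw [Pi.add_apply, h1, h2, Finset.sum_range_succ]
  unfold birkhoffAverage birkhoffSum
  simp only [id]
  filter_upwards [Lp.coeFn_smul ((n : ℝ)⁻¹) (∑ i ∈ Finset.range n,
      (Lp.compMeasurePreserving T hT)^[i] (hf.toLp f) : Lp ℝ 2 μ), h n] with x h1 h2
  rw [h1, Pi.smul_apply, h2]

/-- The mean ergodic theorem in `L¹` for square-integrable functions. -/
theorem Ergodic.tendsto_integral_abs_birkhoffAverage_sub_of_memLp_two {α : Type*}
    [MeasurableSpace α] {μ : Measure α} [IsProbabilityMeasure μ] {T : α → α} (hT : Ergodic T μ)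
    {f : α → ℝ} (hf : MemLp f 2 μ) :
    Tendsto (fun n => ∫ x, |birkhoffAverage ℝ T f n x - ∫ y, f y ∂μ| ∂μ) atTop (𝓝 0) := by
  have hTm := hT.toMeasurePreserving
  have hf1 : Integrable f μ := hf.integrable (by norm_num)
  let U := (Lp.compMeasurePreservingₗᵢ ℝ T hTm (E := ℝ) (p := 2)).toContinuousLinearMap
  have key := U.tendsto_birkhoffAverage_orthogonalProjection
    (LinearIsometry.norm_toContinuousLinearMap_le _) (hf.toLp f)
  set g : Lp ℝ 2 μ := ((U.eqLocus (1 : Lp ℝ 2 μ →L[ℝ] Lp ℝ 2 μ)).orthogonalProjectionOnto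
    (hf.toLp f) : Lp ℝ 2 μ) with hg
  have hgfix : Lp.compMeasurePreserving T hTm g = g :=
    ((U.eqLocus (1 : Lp ℝ 2 μ →L[ℝ] Lp ℝ 2 μ)).orthogonalProjectionOnto (hf.toLp f)).2
  -- The limit is fixed by the Koopman operator, so ergodicity makes it constant.
  obtain ⟨c, hc⟩ := hT.ae_eq_const_of_ae_eq_comp_ae (Lp.aestronglyMeasurable g) (by
    have := Lp.coeFn_compMeasurePreserving g hTm
    rw [hgfix] at this
    exact this.symm)
  have hint : ∀ n, Integrable (birkhoffAverage ℝ T f n) μ := fun n =>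
    (integrable_birkhoffAverage_and_integral_abs_le hTm hf1 n).1
  have hlim : Tendsto (fun n => ∫ x, |birkhoffAverage ℝ T f n x - c| ∂μ) atTop (𝓝 0) := by
    have h0 := (tendsto_iff_norm_sub_tendsto_zero).1 key
    refine squeeze_zero (fun n => integral_nonneg fun x => abs_nonneg _) (fun n => ?_) h0
    set F : Lp ℝ 2 μ := birkhoffAverage ℝ U id n (hf.toLp f) with hF
    have hae : (fun x => birkhoffAverage ℝ T f n x - c) =ᵐ[μ] (F - g : Lp ℝ 2 μ) := by
      filter_upwards [toLp_birkhoffAverage hTm hf n, hc, Lp.coeFn_sub F g] with x h1 h2 h3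
      rw [h3, Pi.sub_apply, h2]
      exact congrArg (· - c) h1.symm
    calc ∫ x, |birkhoffAverage ℝ T f n x - c| ∂μ = ∫ x, ‖(F - g : Lp ℝ 2 μ) x‖ ∂μ :=
          integral_congr_ae (hae.mono fun x hx => by simp only at hx; simp [hx])
      _ = (eLpNorm (F - g : Lp ℝ 2 μ) 1 μ).toReal := by
          rw [integral_norm_eq_lintegral_enorm (Lp.aestronglyMeasurable _),
            eLpNorm_one_eq_lintegral_enorm]
      _ ≤ (eLpNorm (F - g : Lp ℝ 2 μ) 2 μ).toReal :=
          ENNReal.toReal_mono (Lp.eLpNorm_ne_top _)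
            (eLpNorm_le_eLpNorm_of_exponent_le (by norm_num) (Lp.aestronglyMeasurable _))
      _ = ‖F - g‖ := by rw [Lp.norm_def]
  -- Averaging preserves the integral, which identifies the constant.
  have hcf : ∫ y, f y ∂μ = c := by
    have hz : Tendsto (fun _ : ℕ => |∫ y, f y ∂μ - c|) atTop (𝓝 0) := by
      refine squeeze_zero' (Eventually.of_forall fun n => abs_nonneg _) ?_ hlim
      filter_upwards [eventually_ne_atTop 0] with n hn
      rw [← integral_birkhoffAverage hTm hf1 hn]
      calc |∫ x, birkhoffAverage ℝ T f n x ∂μ - c|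
          = |∫ x, (birkhoffAverage ℝ T f n x - c) ∂μ| := by
            rw [integral_sub (hint n) (integrable_const c)]; simp
        _ ≤ _ := abs_integral_le_integral_abs
    have := tendsto_nhds_unique hz tendsto_const_nhds
    linarith [abs_eq_zero.1 this.symm]
  rw [hcf]
  exact hlim

/-- The mean ergodic theorem in `L¹`. -/
theorem Ergodic.tendsto_integral_abs_birkhoffAverage_sub {α : Type*}
    [MeasurableSpace α] {μ : Measure α} [IsProbabilityMeasure μ] {T : α → α} (hT : Ergodic T μ)
    {f : α → ℝ} (hf : Integrable f μ) :
    Tendsto (fun n => ∫ x, |birkhoffAverage ℝ T f n x - ∫ y, f y ∂μ| ∂μ) atTop (𝓝 0) := by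
  have hTm := hT.toMeasurePreserving
  rw [Metric.tendsto_atTop]
  intro ε hε
  -- Simple functions are dense in `L¹`, and averaging is an `L¹` contraction, so the approximation
  -- error does not grow with `n`.
  obtain ⟨g, hfg, hg2⟩ : ∃ g : α → ℝ,
      eLpNorm (f - g) 1 μ < ENNReal.ofReal (ε / 3) ∧ MemLp g 2 μ := by
    obtain ⟨g, hfg, -⟩ := (memLp_one_iff_integrable.2 hf).exists_simpleFunc_eLpNorm_sub_lt
      ENNReal.one_ne_top (ε := ENNReal.ofReal (ε / 3)) (by simpa using hε)
    exact ⟨g, hfg, g.memLp_of_isFiniteMeasure _ _⟩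
  have hg1 : Integrable g μ := hg2.integrable (by norm_num)
  have hd : ∫ x, |f x - g x| ∂μ < ε / 3 := by
    have h1 : ∫ x, |f x - g x| ∂μ = (eLpNorm (f - g) 1 μ).toReal := by
      rw [eLpNorm_one_eq_lintegral_enorm,
        ← integral_norm_eq_lintegral_enorm (hf.sub hg1).aestronglyMeasurable]
      rfl
    rw [h1]
    exact (ENNReal.lt_ofReal_iff_toReal_lt (ne_top_of_lt hfg)).1 hfg
  obtain ⟨n₀, hn₀⟩ := Metric.tendsto_atTop.1
    (hT.tendsto_integral_abs_birkhoffAverage_sub_of_memLp_two hg2) (ε / 3) (by positivity)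
  refine ⟨n₀, fun n hn => ?_⟩
  have hgn := hn₀ n hn
  rw [Real.dist_0_eq_abs] at hgn ⊢
  rw [abs_of_nonneg (integral_nonneg fun x => abs_nonneg _)] at hgn ⊢
  obtain ⟨i1, b1⟩ := integrable_birkhoffAverage_and_integral_abs_le hTm (hf.sub hg1) n
  have i2 := (integrable_birkhoffAverage_and_integral_abs_le hTm hg1 n).1
  have i3 := (integrable_birkhoffAverage_and_integral_abs_le hTm hf n).1
  have hpt : ∀ x, |birkhoffAverage ℝ T f n x - ∫ y, f y ∂μ| ≤
      |birkhoffAverage ℝ T (f - g) n x| + |birkhoffAverage ℝ T g n x - ∫ y, g y ∂μ| +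
        ∫ y, |f y - g y| ∂μ := by
    intro x
    have e1 : birkhoffAverage ℝ T (f - g) n x =
        birkhoffAverage ℝ T f n x - birkhoffAverage ℝ T g n x := by
      rw [birkhoffAverage_sub]; rfl
    have e2 : |∫ y, f y ∂μ - ∫ y, g y ∂μ| ≤ ∫ y, |f y - g y| ∂μ := by
      rw [← integral_sub hf hg1]
      exact abs_integral_le_integral_abs
    rw [e1]
    rw [abs_le] at e2
    have h3 := abs_le.1 (le_refl |birkhoffAverage ℝ T f n x - birkhoffAverage ℝ T g n x|)
    have h4 := abs_le.1 (le_refl |birkhoffAverage ℝ T g n x - ∫ y, g y ∂μ|)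
    rw [abs_le]
    constructor <;> linarith [h3.1, h3.2, h4.1, h4.2, e2.1, e2.2]
  have h2 : Integrable (fun x => |birkhoffAverage ℝ T g n x - ∫ y, g y ∂μ|) μ :=
    (i2.sub (integrable_const _)).abs
  have h3 : Integrable (fun x => |birkhoffAverage ℝ T (f - g) n x| +
      |birkhoffAverage ℝ T g n x - ∫ y, g y ∂μ|) μ := i1.abs.add h2
  calc ∫ x, |birkhoffAverage ℝ T f n x - ∫ y, f y ∂μ| ∂μ
      ≤ ∫ x, (|birkhoffAverage ℝ T (f - g) n x| +
          |birkhoffAverage ℝ T g n x - ∫ y, g y ∂μ| + ∫ y, |f y - g y| ∂μ) ∂μ :=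
        integral_mono (i3.sub (integrable_const _)).abs
          (h3.add (integrable_const _)) hpt
    _ = ∫ x, |birkhoffAverage ℝ T (f - g) n x| ∂μ +
          ∫ x, |birkhoffAverage ℝ T g n x - ∫ y, g y ∂μ| ∂μ + ∫ y, |f y - g y| ∂μ := by
        rw [integral_add h3 (integrable_const _), integral_add i1.abs h2]
        simp
    _ < ε := by
        have : ∫ x, |(f - g) x| ∂μ = ∫ x, |f x - g x| ∂μ := rfl
        linarith

/-! ### The subadditive ergodic theorem in `L¹`. -/

/-- A non-negative random pseudo-distance on the vector space `E`, satisfying the triangle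
inequality almost surely, with integrals of at most linear growth, whose law is invariant and
ergodic under the translations `τ v`. -/
structure IsErgodicSubadditive {E α : Type*} [NormedAddCommGroup E] [NormedSpace ℝ E]
    [MeasurableSpace α] (μ : Measure α) (τ : E → α → α) (Y : E → E → α → ℝ) (C : ℝ) : Prop where
  measurePreserving : ∀ v, MeasurePreserving (τ v) μ μ
  ergodic : ∀ v, v ≠ 0 → Ergodic (τ v) μ
  covariant : ∀ v z w x, Y z w (τ v x) = Y (z - v) (w - v) x
  nonneg : ∀ z w x, 0 ≤ Y z w x
  symm : ∀ z w x, Y z w x = Y w z x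
  triangle : ∀ z w y, ∀ᵐ x ∂μ, Y z y x ≤ Y z w x + Y w y x
  integrable : ∀ z w, Integrable (Y z w) μ
  integral_le : ∀ z w, ∫ x, Y z w x ∂μ ≤ C * (1 + ‖w - z‖)

namespace IsErgodicSubadditive

variable {E α : Type*} [NormedAddCommGroup E] [NormedSpace ℝ E] [MeasurableSpace α]
  {μ : Measure α} {τ : E → α → α} {Y : E → E → α → ℝ} {C : ℝ}

theorem const_nonneg (h : IsErgodicSubadditive μ τ Y C) : 0 ≤ C := by
  have := h.integral_le 0 0
  have h2 : 0 ≤ ∫ x, Y 0 0 x ∂μ := integral_nonneg (h.nonneg 0 0)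
  simpa using h2.trans this

theorem integral_eq (h : IsErgodicSubadditive μ τ Y C) (z w : E) :
    ∫ x, Y z w x ∂μ = ∫ x, Y 0 (w - z) x ∂μ := by
  have hm := h.measurePreserving z
  have := integral_map (μ := μ) (φ := τ z) (f := Y z w) hm.measurable.aemeasurable
    (by rw [hm.map_eq]; exact (h.integrable z w).aestronglyMeasurable)
  rw [hm.map_eq] at this
  simpa [h.covariant] using this

/-- Integrate the triangle inequality through `m • u`; stationarity moves the second leg back to the
origin. -/
theorem subadditive (h : IsErgodicSubadditive μ τ Y C) (u : E) :
    Subadditive fun n : ℕ => ∫ x, Y 0 ((n : ℝ) • u) x ∂μ := by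
  intro m n
  calc ∫ x, Y 0 (((m + n : ℕ) : ℝ) • u) x ∂μ
      ≤ ∫ x, (Y 0 ((m : ℝ) • u) x + Y ((m : ℝ) • u) (((m + n : ℕ) : ℝ) • u) x) ∂μ :=
        integral_mono_ae (h.integrable _ _) ((h.integrable _ _).add (h.integrable _ _))
          (h.triangle _ _ _)
    _ = _ := by
        rw [integral_add (h.integrable _ _) (h.integrable _ _),
          h.integral_eq ((m : ℝ) • u) (((m + n : ℕ) : ℝ) • u)]
        congr 4
        push_cast
        rw [add_smul, add_sub_cancel_left]

theorem bddBelow (h : IsErgodicSubadditive μ τ Y C) (u : E) :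
    BddBelow (Set.range fun n : ℕ => (∫ x, Y 0 ((n : ℝ) • u) x ∂μ) / n) := by
  refine ⟨0, ?_⟩
  rintro _ ⟨n, rfl⟩
  exact div_nonneg (integral_nonneg (h.nonneg _ _)) (Nat.cast_nonneg n)

/-- The asymptotic growth rate of the mean of `Y` in the direction `u`. -/
noncomputable def rate (h : IsErgodicSubadditive μ τ Y C) (u : E) : ℝ := (h.subadditive u).lim

theorem tendsto_rate (h : IsErgodicSubadditive μ τ Y C) (u : E) :
    Tendsto (fun n : ℕ => (∫ x, Y 0 ((n : ℝ) • u) x ∂μ) / n) atTop (𝓝 (h.rate u)) :=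
  (h.subadditive u).tendsto_lim (h.bddBelow u)

/-- The Fekete limit is also the infimum. This error-free lower bound on the mean makes one-sided
estimates sufficient for `L¹` convergence. -/
theorem mul_rate_le (h : IsErgodicSubadditive μ τ Y C) (u : E) (n : ℕ) :
    n * h.rate u ≤ ∫ x, Y 0 ((n : ℝ) • u) x ∂μ := by
  rcases Nat.eq_zero_or_pos n with rfl | hn
  · simpa using integral_nonneg (h.nonneg _ _)
  · have := (h.subadditive u).lim_le_div (h.bddBelow u) hn.ne'
    rw [le_div_iff₀ (by positivity)] at this
    rw [mul_comm]
    exact this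

theorem rate_nonneg (h : IsErgodicSubadditive μ τ Y C) (u : E) : 0 ≤ h.rate u :=
  ge_of_tendsto' (h.tendsto_rate u) fun n =>
    div_nonneg (integral_nonneg (h.nonneg _ _)) (Nat.cast_nonneg n)

theorem rate_le (h : IsErgodicSubadditive μ τ Y C) (u : E) : h.rate u ≤ C * (1 + ‖u‖) := by
  have h1 := h.mul_rate_le u 1
  have h2 := h.integral_le 0 u
  simp only [Nat.cast_one, one_mul, one_smul, sub_zero] at h1 h2
  exact h1.trans h2

/-- Going to `n • u` by way of `n • v` adds at most `C * (1 + n * ‖u - v‖)` to the mean; divide by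
`n`. -/
theorem rate_sub_rate_le (h : IsErgodicSubadditive μ τ Y C) (u v : E) :
    h.rate u - h.rate v ≤ C * ‖u - v‖ := by
  have hlim : Tendsto (fun n : ℕ => (∫ x, Y 0 ((n : ℝ) • v) x ∂μ) / n + (C / n + C * ‖u - v‖))
      atTop (𝓝 (h.rate v + (0 + C * ‖u - v‖))) :=
    (h.tendsto_rate v).add ((tendsto_const_div_atTop_nhds_zero_nat C).add tendsto_const_nhds)
  have : h.rate u ≤ h.rate v + (0 + C * ‖u - v‖) := by
    refine le_of_tendsto_of_tendsto (h.tendsto_rate u) hlim ?_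
    filter_upwards [eventually_gt_atTop 0] with n hn
    have hn' : (0 : ℝ) < n := by exact_mod_cast hn
    have h1 : ∫ x, Y 0 ((n : ℝ) • u) x ∂μ ≤ ∫ x, Y 0 ((n : ℝ) • v) x ∂μ +
        C * (1 + n * ‖u - v‖) := by
      calc ∫ x, Y 0 ((n : ℝ) • u) x ∂μ
          ≤ ∫ x, (Y 0 ((n : ℝ) • v) x + Y ((n : ℝ) • v) ((n : ℝ) • u) x) ∂μ :=
            integral_mono_ae (h.integrable _ _) ((h.integrable _ _).add (h.integrable _ _))
              (h.triangle _ _ _)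
        _ = ∫ x, Y 0 ((n : ℝ) • v) x ∂μ + ∫ x, Y ((n : ℝ) • v) ((n : ℝ) • u) x ∂μ :=
            integral_add (h.integrable _ _) (h.integrable _ _)
        _ ≤ _ := by
            gcongr
            refine (h.integral_le _ _).trans_eq ?_
            rw [← smul_sub, norm_smul, Real.norm_natCast]
    have e : (∫ x, Y 0 ((n : ℝ) • v) x ∂μ) / n + (C / n + C * ‖u - v‖) =
        (∫ x, Y 0 ((n : ℝ) • v) x ∂μ + C * (1 + n * ‖u - v‖)) / n := by
      field_simp
    rw [e]
    gcongr
  linarith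

theorem abs_rate_sub_rate_le (h : IsErgodicSubadditive μ τ Y C) (u v : E) :
    |h.rate u - h.rate v| ≤ C * ‖u - v‖ := by
  rw [abs_le]
  have h1 := h.rate_sub_rate_le u v
  have h2 := h.rate_sub_rate_le v u
  rw [norm_sub_rev] at h2
  constructor <;> linarith

theorem iterate_apply (h : IsErgodicSubadditive μ τ Y C) (v z w : E) (i : ℕ) (x : α) :
    Y z w ((τ v)^[i] x) = Y (z - (i : ℝ) • v) (w - (i : ℝ) • v) x := by
  induction i generalizing z w with
  | zero => simp
  | succ i ih =>
    rw [Function.iterate_succ_apply', h.covariant, ih]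
    congr 1 <;> · push_cast; rw [add_smul, one_smul]; abel

/-- Each leg from `i • v` to `(i + 1) • v` is the first leg seen after `i` translations by `-v`. The
term `Y 0 0` covers `m = 0`, since `Y` need not vanish on the diagonal. -/
theorem le_sum_iterate (h : IsErgodicSubadditive μ τ Y C) (v : E) (m : ℕ) :
    ∀ᵐ x ∂μ, Y 0 ((m : ℝ) • v) x ≤
      Y 0 0 x + ∑ i ∈ Finset.range m, Y 0 v ((τ (-v))^[i] x) := by
  induction m with
  | zero => simp
  | succ m ih =>
    filter_upwards [ih, h.triangle 0 ((m : ℝ) • v) (((m + 1 : ℕ) : ℝ) • v)] with x h1 h2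
    have e : Y 0 v ((τ (-v))^[m] x) = Y ((m : ℝ) • v) (((m + 1 : ℕ) : ℝ) • v) x := by
      rw [h.iterate_apply]
      congr 1
      · simp
      · push_cast; rw [add_smul, one_smul, smul_neg, sub_neg_eq_add, add_comm]
    rw [Finset.sum_range_succ, e]
    linarith

/-- The subadditive ergodic theorem in `L¹` along a ray. -/
theorem tendsto_integral_abs_sub_div [IsProbabilityMeasure μ] (h : IsErgodicSubadditive μ τ Y C)
    {u : E} (hu : u ≠ 0) :
    Tendsto (fun n : ℕ => (∫ x, |Y 0 ((n : ℝ) • u) x - n * h.rate u| ∂μ) / n) atTop (𝓝 0) := by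
  have hC := h.const_nonneg
  rw [Metric.tendsto_atTop']
  intro ε₀ hε₀
  obtain ⟨ε, hε, rfl⟩ : ∃ ε, 0 < ε ∧ ε₀ = 8 * ε := ⟨ε₀ / 8, by positivity, by ring⟩
  obtain ⟨k, hk0, hk⟩ : ∃ k : ℕ, 0 < k ∧
      ∫ x, Y 0 ((k : ℝ) • u) x ∂μ ≤ k * (h.rate u + ε) := by
    have h1 : ∀ᶠ n : ℕ in atTop, (∫ x, Y 0 ((n : ℝ) • u) x ∂μ) / n < h.rate u + ε :=
      (h.tendsto_rate u).eventually (gt_mem_nhds (by linarith))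
    obtain ⟨k, hk, hk0⟩ := (h1.and (eventually_gt_atTop 0)).exists
    refine ⟨k, hk0, ?_⟩
    rw [div_lt_iff₀ (by positivity)] at hk
    linarith
  have hk' : (0 : ℝ) < k := by exact_mod_cast hk0
  set v : E := (k : ℝ) • u with hv
  have hv0 : -v ≠ 0 := by simp [hv, hk0.ne', hu]
  have herg := (h.ergodic (-v) hv0).tendsto_integral_abs_birkhoffAverage_sub (h.integrable 0 v)
  set a : ℝ := ∫ x, Y 0 v x ∂μ with ha
  set A : ℕ → α → ℝ := birkhoffAverage ℝ (τ (-v)) (Y 0 v) with hA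
  -- A distance `n` contains `n / k` whole blocks of length `k`.
  have herg' := herg.comp (Nat.tendsto_div_const_atTop hk0.ne')
  obtain ⟨n₁, hn₁⟩ := Metric.tendsto_atTop.1 herg' ε hε
  -- Beyond `n₂` the terms bounded in `n`, from the diagonal and the incomplete last block, are at
  -- most `n * ε`.
  obtain ⟨n₂, hn₂⟩ := exists_nat_ge ((2 * C + C * (k * ‖u‖)) / ε)
  refine ⟨max n₁ n₂, fun n hn => ?_⟩
  have hn1 : n₁ ≤ n := (le_max_left _ _).trans hn.le
  have hn2 : (n₂ : ℝ) ≤ n := by exact_mod_cast (le_max_right _ _).trans hn.le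
  have hn0 : (0 : ℝ) < n := by
    have : 0 < n := lt_of_le_of_lt (Nat.zero_le _) hn
    exact_mod_cast this
  have hlow := hn₁ n hn1
  simp only [Function.comp_apply, Real.dist_0_eq_abs] at hlow
  rw [abs_of_nonneg (integral_nonneg fun x => abs_nonneg _)] at hlow
  rw [Real.dist_0_eq_abs, abs_of_nonneg (div_nonneg (integral_nonneg fun x => abs_nonneg _)
    hn0.le), div_lt_iff₀ hn0]
  set m := n / k with hm
  have hmk : (m : ℝ) * k ≤ n := by exact_mod_cast Nat.div_mul_le_self n k
  have hmk' : (n : ℝ) - m * k ≤ k := by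
    have : n < m * k + k := by
      rw [hm]; exact Nat.lt_div_mul_add hk0
    have : (n : ℝ) < m * k + k := by exact_mod_cast this
    linarith
  have hmn : (m : ℝ) ≤ n := by exact_mod_cast Nat.div_le_self n k
  have hiA : Integrable (fun x => |A m x - a|) μ :=
    ((integrable_birkhoffAverage_and_integral_abs_le
      (h.measurePreserving (-v)) (h.integrable 0 v) m).1.sub (integrable_const _)).abs
  -- If `Z ≤ U` and `0 ≤ U` then `|Z| ≤ 2 * U - Z`. Here `Z` has non-negative mean by `mul_rate_le`,
  -- so only the mean of `U` matters.
  have hpt : ∀ᵐ x ∂μ, |Y 0 ((n : ℝ) • u) x - n * h.rate u| ≤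
      2 * (Y 0 0 x + m * |A m x - a| + n * ε + Y ((m : ℝ) • v) ((n : ℝ) • u) x) -
        (Y 0 ((n : ℝ) • u) x - n * h.rate u) := by
    filter_upwards [h.le_sum_iterate v m, h.triangle 0 ((m : ℝ) • v) ((n : ℝ) • u)] with x h1 h2
    have e1 : ∑ i ∈ Finset.range m, Y 0 v ((τ (-v))^[i] x) = m * A m x := by
      rw [hA]
      simp only [birkhoffAverage, birkhoffSum, smul_eq_mul]
      rcases Nat.eq_zero_or_pos m with h0 | h0
      · simp [h0]
      · field_simp
    rw [e1] at h1
    have e2 : (m : ℝ) * A m x ≤ m * |A m x - a| + m * a := by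
      rw [← mul_add]
      gcongr
      linarith [le_abs_self (A m x - a)]
    have e3 : (m : ℝ) * a ≤ n * (h.rate u + ε) := by
      calc (m : ℝ) * a ≤ m * (k * (h.rate u + ε)) := by gcongr
        _ = (m * k) * (h.rate u + ε) := by ring
        _ ≤ _ := by
          have := h.rate_nonneg u
          gcongr
    have hp1 := h.nonneg 0 0 x
    have hp2 := h.nonneg ((m : ℝ) • v) ((n : ℝ) • u) x
    have hp3 : 0 ≤ (m : ℝ) * |A m x - a| := by positivity
    have hp4 : 0 ≤ (n : ℝ) * ε := by positivity
    rcases abs_cases (Y 0 ((n : ℝ) • u) x - n * h.rate u) with ⟨e, _⟩ | ⟨e, _⟩ <;>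
      rw [e] <;> linarith
  have i1 : Integrable (fun x => Y 0 0 x + m * |A m x - a|) μ :=
    (h.integrable 0 0).add (hiA.const_mul _)
  have i2 : Integrable (fun x => Y 0 0 x + m * |A m x - a| + n * ε) μ :=
    i1.add (integrable_const _)
  have i3 : Integrable (fun x => Y 0 0 x + m * |A m x - a| + n * ε +
      Y ((m : ℝ) • v) ((n : ℝ) • u) x) μ := i2.add (h.integrable _ _)
  have i4 : Integrable (fun x => Y 0 ((n : ℝ) • u) x - n * h.rate u) μ :=
    (h.integrable _ _).sub (integrable_const _)
  have hb := integral_mono_ae i4.abs ((i3.const_mul 2).sub i4) hpt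
  simp only [Pi.sub_apply] at hb
  rw [integral_sub (i3.const_mul 2) i4, integral_const_mul, integral_add i2 (h.integrable _ _),
    integral_add i1 (integrable_const _), integral_add (h.integrable 0 0) (hiA.const_mul _),
    integral_const_mul, integral_sub (h.integrable _ _) (integrable_const _)] at hb
  simp only [integral_const, probReal_univ, smul_eq_mul, one_mul] at hb
  have b1 := h.integral_le 0 0
  have b2 : ∫ x, Y ((m : ℝ) • v) ((n : ℝ) • u) x ∂μ ≤ C * (1 + k * ‖u‖) := by
    refine (h.integral_le _ _).trans ?_
    have : ‖(n : ℝ) • u - (m : ℝ) • v‖ ≤ k * ‖u‖ := by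
      rw [hv, smul_smul, ← sub_smul, norm_smul, Real.norm_eq_abs, abs_of_nonneg (by linarith)]
      gcongr
    gcongr
  have b3 := h.mul_rate_le u n
  have b4 : (m : ℝ) * ∫ x, |A m x - a| ∂μ ≤ n * ε := by
    have : 0 ≤ ∫ x, |A m x - a| ∂μ := integral_nonneg fun x => abs_nonneg _
    gcongr
  have b5 : 2 * C + C * (k * ‖u‖) ≤ n * ε := by
    have := hn₂.trans hn2
    rwa [div_le_iff₀ hε] at this
  simp only [sub_zero, norm_zero, add_zero, mul_one] at b1
  have : 0 < (n : ℝ) * ε := by positivity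
  linarith

/-- The subadditive ergodic theorem in `L¹`, uniformly in the direction. -/
theorem exists_forall_integral_abs_sub_le [ProperSpace E] [IsProbabilityMeasure μ]
    (h : IsErgodicSubadditive μ τ Y C) {ε : ℝ} (hε : 0 < ε) :
    ∃ R : ℝ, ∀ r, R ≤ r → ∀ u : E, ‖u‖ = 1 →
      ∫ x, |Y 0 (r • u) x - r * h.rate u| ∂μ ≤ ε * r := by
  have hC := h.const_nonneg
  obtain ⟨η, hη, rfl⟩ : ∃ η, 0 < η ∧ ε = 3 * η := ⟨ε / 3, by positivity, by ring⟩
  set δ := η / (2 * C + 1) with hδ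
  have hδ0 : 0 < δ := by positivity
  have hCδ : 2 * C * δ ≤ η := by
    rw [hδ, mul_div_assoc', div_le_iff₀ (by positivity)]
    nlinarith
  -- Ray convergence holds simultaneously over a finite net of directions.
  obtain ⟨t, hts, htf, ht⟩ := (isCompact_sphere (0 : E) 1).finite_cover_balls hδ0
  have hev : ∀ᶠ n : ℕ in atTop, ∀ v ∈ t,
      ∫ x, |Y 0 ((n : ℝ) • v) x - n * h.rate v| ∂μ ≤ n * η := by
    rw [htf.eventually_all]
    intro v hv
    have hv1 : ‖v‖ = 1 := by simpa using hts hv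
    have hv0 : v ≠ 0 := by rintro rfl; simp at hv1
    filter_upwards [(h.tendsto_integral_abs_sub_div hv0).eventually (gt_mem_nhds hη),
      eventually_gt_atTop 0] with n h1 h2
    rw [div_lt_iff₀ (by positivity)] at h1
    linarith
  obtain ⟨n₀, hn₀⟩ := eventually_atTop.1 hev
  -- Three errors of at most `η * r` each: convergence on the net, the change of direction `2 * C *
  -- δ * r`, and the bounded terms `4 * C`, which include rounding `r` down.
  refine ⟨max n₀ (max 0 (4 * C / η)), fun r hr u hu => ?_⟩
  have hr1 : (n₀ : ℝ) ≤ r := (le_max_left _ _).trans hr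
  have hr0 : 0 ≤ r := (le_max_left _ _).trans ((le_max_right _ _).trans hr)
  have hr2 : 4 * C ≤ r * η := by
    have := (le_max_right _ _).trans ((le_max_right _ _).trans hr)
    rwa [div_le_iff₀ hη] at this
  set n := ⌊r⌋₊ with hn
  have hn1 : n₀ ≤ n := Nat.le_floor hr1
  have hnr : (n : ℝ) ≤ r := Nat.floor_le hr0
  have hnr' : r < n + 1 := Nat.lt_floor_add_one r
  obtain ⟨v, hvt, huv⟩ : ∃ v ∈ t, ‖u - v‖ < δ := by
    have := ht (show u ∈ Metric.sphere (0 : E) 1 by simpa using hu)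
    simpa [dist_eq_norm] using this
  have hv1 : ‖v‖ = 1 := by simpa using hts hvt
  have hnet := hn₀ n hn1 v hvt
  have hdist : ‖r • u - (n : ℝ) • v‖ ≤ r * δ + 1 := by
    have e : r • u - (n : ℝ) • v = r • (u - v) + (r - n) • v := by
      rw [smul_sub, sub_smul]; abel
    rw [e]
    refine (norm_add_le _ _).trans ?_
    rw [norm_smul, norm_smul, hv1, Real.norm_eq_abs, Real.norm_eq_abs, abs_of_nonneg hr0,
      abs_of_nonneg (by linarith)]
    gcongr
    linarith
  have hrate : |(n : ℝ) * h.rate v - r * h.rate u| ≤ r * (C * δ) + 2 * C := by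
    have e : (n : ℝ) * h.rate v - r * h.rate u =
        -(r * (h.rate u - h.rate v)) - (r - n) * h.rate v := by ring
    have h1 := h.abs_rate_sub_rate_le u v
    have h2 := h.rate_nonneg v
    have h3 := h.rate_le v
    rw [hv1] at h3
    have h4 : (r - n) * h.rate v ≤ 1 * (2 * C) := by
      apply mul_le_mul <;> linarith
    have h5 : 0 ≤ (r - n) * h.rate v := mul_nonneg (by linarith) h2
    have h6 : |r * (h.rate u - h.rate v)| ≤ r * (C * δ) := by
      rw [abs_mul, abs_of_nonneg hr0]
      have : C * ‖u - v‖ ≤ C * δ := by gcongr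
      gcongr
      linarith
    rw [abs_le] at h6 ⊢
    rw [e]
    constructor <;> linarith [h6.1, h6.2]
  have hpt : ∀ᵐ x ∂μ, |Y 0 (r • u) x - r * h.rate u| ≤
      |Y 0 ((n : ℝ) • v) x - n * h.rate v| + Y ((n : ℝ) • v) (r • u) x +
        (r * (C * δ) + 2 * C) := by
    filter_upwards [h.triangle 0 ((n : ℝ) • v) (r • u), h.triangle 0 (r • u) ((n : ℝ) • v)]
      with x h1 h2
    rw [h.symm (r • u) ((n : ℝ) • v)] at h2
    have h3 := abs_le.1 (le_refl |Y 0 ((n : ℝ) • v) x - n * h.rate v|)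
    rw [abs_le] at hrate ⊢
    constructor <;> linarith [h3.1, h3.2, hrate.1, hrate.2]
  have i1 : Integrable (fun x => |Y 0 ((n : ℝ) • v) x - n * h.rate v|) μ :=
    ((h.integrable _ _).sub (integrable_const _)).abs
  have i2 : Integrable (fun x => |Y 0 ((n : ℝ) • v) x - n * h.rate v| +
      Y ((n : ℝ) • v) (r • u) x) μ := i1.add (h.integrable _ _)
  have hb := integral_mono_ae ((h.integrable 0 (r • u)).sub (integrable_const (r * h.rate u))).abs
    (i2.add (integrable_const _)) hpt
  simp only [Pi.add_apply, Pi.sub_apply] at hb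
  rw [integral_add i2 (integrable_const _), integral_add i1 (h.integrable _ _)] at hb
  simp only [integral_const, probReal_univ, smul_eq_mul, one_mul] at hb
  have b2 : ∫ x, Y ((n : ℝ) • v) (r • u) x ∂μ ≤ C * (1 + (r * δ + 1)) :=
    (h.integral_le _ _).trans (by gcongr)
  have b3 : (n : ℝ) * η ≤ r * η := by gcongr
  have b4 : r * (2 * C * δ) ≤ r * η := by gcongr
  linarith

end IsErgodicSubadditive

/-! ### Geometry of strips and cells. -/

/-- The half-open rectangle `[z₀, z₀ + k) × [z₁, z₁ + 1)`. -/
noncomputable def strip (z : Plane) (k : ℝ) : Set Plane :=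
  {x | (z 0 ≤ x 0 ∧ x 0 < z 0 + k) ∧ (z 1 ≤ x 1 ∧ x 1 < z 1 + 1)}

/-- The unit square `[z₀ + k, z₀ + k + 1) × [z₁, z₁ + 1)`. -/
noncomputable def cell (z : Plane) (k : ℕ) : Set Plane := strip (z + (k : ℝ) • EuclideanSpace.single 0 1) 1

theorem mem_cell {z x : Plane} {k : ℕ} : x ∈ cell z k ↔
    (z 0 + k ≤ x 0 ∧ x 0 < z 0 + k + 1) ∧ (z 1 ≤ x 1 ∧ x 1 < z 1 + 1) := by
  simp [cell, strip]

theorem vadd_strip (v z : Plane) (k : ℝ) : v +ᵥ strip z k = strip (v + z) k := by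
  ext x
  rw [Set.mem_vadd_set_iff_neg_vadd_mem]
  simp only [strip, Set.mem_ofPred_eq, vadd_eq_add, PiLp.add_apply, PiLp.neg_apply]
  constructor <;> rintro ⟨⟨_, _⟩, _, _⟩ <;> refine ⟨⟨?_, ?_⟩, ?_, ?_⟩ <;> linarith

theorem preimage_add_right_strip (v z : Plane) (k : ℝ) :
    (fun x => x + v) ⁻¹' strip z k = strip (z - v) k := by
  ext x
  simp only [strip, Set.mem_ofPred_eq, PiLp.add_apply, PiLp.sub_apply, Set.mem_preimage]
  constructor <;> rintro ⟨⟨_, _⟩, _, _⟩ <;> refine ⟨⟨?_, ?_⟩, ?_, ?_⟩ <;> linarith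

theorem preimage_add_right_cell (v z : Plane) (k : ℕ) :
    (fun x => x + v) ⁻¹' cell z k = cell (z - v) k := by
  rw [cell, preimage_add_right_strip, cell, sub_add_eq_add_sub]

theorem strip_eq_preimage (z : Plane) (k : ℝ) :
    strip z k = (WithLp.ofLp : Plane → Fin 2 → ℝ) ⁻¹'
      (Set.univ.pi fun i => Set.Ico (z i) ((![z 0 + k, z 1 + 1] : Fin 2 → ℝ) i)) := by
  ext x
  simp [strip, Fin.forall_fin_two]

theorem measurableSet_strip (z : Plane) (k : ℝ) : MeasurableSet (strip z k) := by
  rw [strip_eq_preimage]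
  exact (PiLp.volume_preserving_ofLp (Fin 2)).measurable
    (MeasurableSet.univ_pi fun i => measurableSet_Ico)

theorem volume_strip (z : Plane) (k : ℝ) : volume (strip z k) = ENNReal.ofReal k := by
  rw [strip_eq_preimage, (PiLp.volume_preserving_ofLp (Fin 2)).measure_preimage
    (MeasurableSet.univ_pi fun i => measurableSet_Ico).nullMeasurableSet, Real.volume_pi_Ico]
  simp

theorem isBounded_strip (z : Plane) (k : ℝ) : Bornology.IsBounded (strip z k) := by
  rw [strip_eq_preimage]
  refine (PiLp.antilipschitzWith_ofLp 2 (fun _ : Fin 2 => ℝ)).isBounded_preimage ?_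
  exact (Metric.isBounded_Icc z.ofLp (![z 0 + k, z 1 + 1])).subset fun x hx =>
    ⟨fun i => (hx i trivial).1, fun i => (hx i trivial).2.le⟩

theorem measurableSet_cell (z : Plane) (k : ℕ) : MeasurableSet (cell z k) :=
  measurableSet_strip _ _

theorem cell_subset_strip (z : Plane) {j k : ℕ} (h : j < k) : cell z j ⊆ strip z k := by
  intro x hx
  rw [mem_cell] at hx
  have h1 : (j : ℝ) + 1 ≤ k := by exact_mod_cast h
  have h2 : (0 : ℝ) ≤ j := Nat.cast_nonneg j
  exact ⟨⟨by linarith [hx.1.1], by linarith [hx.1.2]⟩, hx.2⟩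

theorem strip_succ_diff_subset_cell (z : Plane) (k : ℕ) :
    strip z ((k + 1 : ℕ) : ℝ) \ strip z k ⊆ cell z k := by
  rintro x ⟨hx, hx'⟩
  rw [mem_cell]
  refine ⟨⟨?_, ?_⟩, hx.2⟩
  · by_contra hlt
    exact hx' ⟨⟨hx.1.1, not_le.1 hlt⟩, hx.2⟩
  · have := hx.1.2
    push_cast at this
    linarith

/-! ### Largest route-lengths, markers, and their measurability. -/

namespace RouteSystem

/-- The largest route-length between a point in `A` and a point in `B`. -/
noncomputable def supDist (N : RouteSystem) (A B : Set Plane) : ℝ≥0∞ :=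
  ⨆ x : N.points, ⨆ y : N.points, ⨆ _ : (x : Plane) ∈ A ∧ (y : Plane) ∈ B,
    ENNReal.ofReal (N.d x y)

/-- The first of the cells `cell z 0`, `cell z 1`, … which contains a point. -/
noncomputable def marker (N : RouteSystem) (z : Plane) : Set Plane :=
  {x | ∃ k : ℕ, Disjoint N.points (strip z k) ∧ x ∈ cell z k}

variable {N : RouteSystem} {A B C : Set Plane}

theorem le_supDist {x y : N.points} (hx : (x : Plane) ∈ A) (hy : (y : Plane) ∈ B) :
    ENNReal.ofReal (N.d x y) ≤ N.supDist A B :=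
  le_iSup_of_le x (le_iSup_of_le y (le_iSup_of_le ⟨hx, hy⟩ le_rfl))

theorem supDist_le_iff {c : ℝ≥0∞} : N.supDist A B ≤ c ↔
    ∀ x y : N.points, (x : Plane) ∈ A → (y : Plane) ∈ B → ENNReal.ofReal (N.d x y) ≤ c := by
  simp [supDist, iSup_le_iff]

theorem lt_supDist_iff {c : ℝ≥0∞} : c < N.supDist A B ↔
    ∃ x y : N.points, (x : Plane) ∈ A ∧ (y : Plane) ∈ B ∧ c < ENNReal.ofReal (N.d x y) := by
  rw [← not_le, supDist_le_iff]
  push Not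
  rfl

theorem supDist_comm (N : RouteSystem) (A B : Set Plane) : N.supDist A B = N.supDist B A := by
  apply le_antisymm <;>
  · rw [supDist_le_iff]
    intro x y hx hy
    rw [N.d_symm]
    exact le_supDist hy hx

theorem supDist_iUnion_right {ι : Type*} (N : RouteSystem) (A : Set Plane) (B : ι → Set Plane) :
    N.supDist A (⋃ i, B i) = ⨆ i, N.supDist A (B i) := by
  refine le_antisymm (supDist_le_iff.2 fun x y hx hy => ?_) (iSup_le fun i => ?_)
  · obtain ⟨i, hi⟩ := Set.mem_iUnion.1 hy
    exact (le_supDist hx hi).trans (le_iSup (fun i => N.supDist A (B i)) i)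
  · exact supDist_le_iff.2 fun x y hx hy => le_supDist hx (Set.mem_iUnion_of_mem i hy)

@[simp]
theorem supDist_empty_right (N : RouteSystem) (A : Set Plane) : N.supDist A ∅ = 0 := by
  simp [supDist]

/-- All routes are compared through one point of `B`; with no such point the right side would be
`0`. -/
theorem supDist_triangle (h : (N.points ∩ B).Nonempty) :
    N.supDist A C ≤ N.supDist A B + N.supDist B C := by
  obtain ⟨y, hy, hyB⟩ := h
  rw [supDist_le_iff]
  intro x z hx hz
  calc ENNReal.ofReal (N.d x z) ≤ ENNReal.ofReal (N.d x ⟨y, hy⟩ + N.d ⟨y, hy⟩ z) :=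
        ENNReal.ofReal_le_ofReal (N.d_triangle _ _ _)
    _ = ENNReal.ofReal (N.d x ⟨y, hy⟩) + ENNReal.ofReal (N.d ⟨y, hy⟩ z) :=
        ENNReal.ofReal_add (N.d_nonneg _ _) (N.d_nonneg _ _)
    _ ≤ _ := add_le_add (le_supDist hx hyB) (le_supDist hyB hz)

theorem supDist_ne_top (hA : (N.points ∩ A).Finite) (hB : (N.points ∩ B).Finite) :
    N.supDist A B ≠ ∞ := by
  have hfin : {p : N.points × N.points | (p.1 : Plane) ∈ A ∧ (p.2 : Plane) ∈ B}.Finite := by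
    have hA' : {x : N.points | (x : Plane) ∈ A}.Finite :=
      Set.Finite.of_finite_image (hA.subset (by rintro _ ⟨x, hx, rfl⟩; exact ⟨x.2, hx⟩))
        Subtype.val_injective.injOn
    have hB' : {x : N.points | (x : Plane) ∈ B}.Finite :=
      Set.Finite.of_finite_image (hB.subset (by rintro _ ⟨x, hx, rfl⟩; exact ⟨x.2, hx⟩))
        Subtype.val_injective.injOn
    exact hA'.prod hB'
  obtain ⟨M, hM⟩ := (hfin.image fun p => N.d p.1 p.2).bddAbove
  refine ne_top_of_le_ne_top (ENNReal.ofReal_ne_top (r := M)) (supDist_le_iff.2 ?_)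
  exact fun x y hx hy => ENNReal.ofReal_le_ofReal (hM ⟨(x, y), ⟨hx, hy⟩, rfl⟩)

/-- As a set, the marker also contains the void cells before the first occupied one, and is
unbounded if the half-strip is void. A point in it excludes all later cells, whose preceding strips
contain that point. -/
theorem finite_points_inter_marker (N : RouteSystem) (z : Plane) :
    (N.points ∩ N.marker z).Finite := by
  rcases (N.points ∩ N.marker z).eq_empty_or_nonempty with h | ⟨x, hx, k, -, hxk⟩
  · simp [h]
  refine (N.locallyFinite _ (isBounded_strip z ((k + 1 : ℕ) : ℝ))).subset ?_
  rintro y ⟨hy, j, hj, hyj⟩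
  refine ⟨hy, cell_subset_strip z ?_ hyj⟩
  by_contra hlt
  exact Set.disjoint_left.1 hj hx (cell_subset_strip z (by omega) hxk)

theorem nonempty_points_inter_marker {z : Plane} {k : ℕ}
    (h : ¬ Disjoint N.points (strip z k)) : (N.points ∩ N.marker z).Nonempty := by
  classical
  have hex : ∃ k : ℕ, ¬ Disjoint N.points (strip z k) := ⟨k, h⟩
  -- The strip of length `0` is empty, so the first strip that is hit has a predecessor.
  obtain ⟨m, hm⟩ : ∃ m, Nat.find hex = m + 1 := by
    refine Nat.exists_eq_succ_of_ne_zero fun h0 => Nat.find_spec hex ?_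
    rw [h0, Set.disjoint_left]
    rintro x - hx
    have := hx.1.1.trans_lt hx.1.2
    simp at this
  have h1 : Disjoint N.points (strip z m) := by
    by_contra h2
    exact Nat.find_min hex (m := m) (by omega) h2
  obtain ⟨x, hx, hxs⟩ := Set.not_disjoint_iff.1 (Nat.find_spec hex)
  rw [hm] at hxs
  exact ⟨x, hx, m, h1, strip_succ_diff_subset_cell z m ⟨hxs, Set.disjoint_left.1 h1 hx⟩⟩

open Classical in
theorem marker_eq_iUnion (N : RouteSystem) (z : Plane) :
    N.marker z = ⋃ k : ℕ, if Disjoint N.points (strip z k) then cell z k else ∅ := by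
  ext x
  simp only [marker, Set.mem_ofPred_eq, Set.mem_iUnion]
  refine exists_congr fun k => ?_
  split_ifs with h <;> simp [h]

open Classical in
-- Replaces the random marker by a countable supremum over fixed cells, for use in measurability and
-- in moment bounds.
theorem supDist_marker_right (N : RouteSystem) (A : Set Plane) (z : Plane) :
    N.supDist A (N.marker z) =
      ⨆ k : ℕ, if Disjoint N.points (strip z k) then N.supDist A (cell z k) else 0 := by
  rw [marker_eq_iUnion, supDist_iUnion_right]
  refine iSup_congr fun k => ?_
  split_ifs <;> simp

open Classical in
theorem supDist_marker_left (N : RouteSystem) (z : Plane) (B : Set Plane) :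
    N.supDist (N.marker z) B =
      ⨆ k : ℕ, if Disjoint N.points (strip z k) then N.supDist (cell z k) B else 0 := by
  rw [supDist_comm, supDist_marker_right]
  simp_rw [supDist_comm N B]

/-! ### Translations -/

/-- The points of a system and those of its translate correspond to each other. -/
noncomputable def translateEquiv (v : Plane) (N : RouteSystem) : (N.translate v).points ≃ N.points where
  toFun x := ⟨(x : Plane) - v, x.2⟩
  invFun x := ⟨(x : Plane) + v, by
    change (x : Plane) + v - v ∈ N.points
    rw [add_sub_cancel_right]; exact x.2⟩
  left_inv x := Subtype.ext (sub_add_cancel _ _)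
  right_inv x := Subtype.ext (add_sub_cancel_right _ _)

theorem translate_d_symm (v : Plane) (N : RouteSystem) (x y : N.points) :
    (N.translate v).d ((translateEquiv v N).symm x) ((translateEquiv v N).symm y) = N.d x y := by
  change N.d _ _ = _
  congr 1 <;> exact Subtype.ext (add_sub_cancel_right _ _)

theorem supDist_translate (v : Plane) (N : RouteSystem) (A B : Set Plane) :
    (N.translate v).supDist A B =
      N.supDist ((fun x => x + v) ⁻¹' A) ((fun x => x + v) ⁻¹' B) := by
  rw [supDist, ← (translateEquiv v N).symm.iSup_comp]
  refine iSup_congr fun x => ?_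
  rw [← (translateEquiv v N).symm.iSup_comp]
  refine iSup_congr fun y => ?_
  rw [translate_d_symm]
  rfl

theorem disjoint_translate (v : Plane) (N : RouteSystem) (A : Set Plane) :
    Disjoint (N.translate v).points A ↔ Disjoint N.points ((fun x => x + v) ⁻¹' A) := by
  simp only [Set.disjoint_left]
  constructor
  · intro h x hx hxA
    exact h (a := x + v) (by change x + v - v ∈ N.points; rwa [add_sub_cancel_right]) hxA
  · intro h x hx hxA
    exact h (a := x - v) hx (by simpa using hxA)

theorem preimage_marker_translate (v : Plane) (N : RouteSystem) (z : Plane) :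
    (fun x => x + v) ⁻¹' (N.translate v).marker z = N.marker (z - v) := by
  ext x
  change (∃ k : ℕ, _ ∧ x ∈ (fun x => x + v) ⁻¹' cell z k) ↔ ∃ k : ℕ, _
  simp only [disjoint_translate, preimage_add_right_strip, preimage_add_right_cell]

/-! ### Sums over pairs -/

/-- The form of an integral against `toMeasure`. -/
theorem pairSum_eq_tsum (N : RouteSystem) (A B : Set Plane) (f : ℝ → ℝ≥0∞) :
    N.pairSum A B f = ∑' p : N.points × N.points,
      {p : Plane × Plane × ℝ | p.1 ∈ A ∧ p.2.1 ∈ B}.indicator (fun p => f p.2.2)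
        ((p.1 : Plane), (p.2 : Plane), N.d p.1 p.2) := by
  classical
  rw [ENNReal.tsum_prod (f := fun x y : N.points =>
    {p : Plane × Plane × ℝ | p.1 ∈ A ∧ p.2.1 ∈ B}.indicator (fun p => f p.2.2)
      ((x : Plane), (y : Plane), N.d x y))]
  unfold pairSum
  refine (tsum_subtype {x : N.points | (x : Plane) ∈ A} fun x =>
    ∑' y : {y : N.points // (y : Plane) ∈ B}, f (N.d x y.1)).trans ?_
  refine tsum_congr fun x => ?_
  rw [Set.indicator_apply]
  split_ifs with hx
  · refine (tsum_subtype {y : N.points | (y : Plane) ∈ B} fun y => f (N.d x y)).trans ?_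
    refine tsum_congr fun y => ?_
    simp only [Set.indicator_apply, Set.mem_ofPred_eq] at hx ⊢
    simp [hx]
  · simp only [Set.mem_ofPred_eq] at hx
    simp [hx]

theorem pairSum_translate (v : Plane) (N : RouteSystem) (A B : Set Plane) (f : ℝ → ℝ≥0∞) :
    (N.translate v).pairSum A B f =
      N.pairSum ((fun x => x + v) ⁻¹' A) ((fun x => x + v) ⁻¹' B) f := by
  rw [pairSum_eq_tsum, pairSum_eq_tsum,
    ← ((translateEquiv v N).symm.prodCongr (translateEquiv v N).symm).tsum_eq]
  refine tsum_congr fun p => ?_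
  change Set.indicator _ _ ((((translateEquiv v N).symm p.1 : (N.translate v).points) : Plane),
    (((translateEquiv v N).symm p.2 : (N.translate v).points) : Plane),
    (N.translate v).d ((translateEquiv v N).symm p.1) ((translateEquiv v N).symm p.2)) = _
  rw [translate_d_symm]
  rfl

theorem pairSum_mono {f g : ℝ → ℝ≥0∞} (h : ∀ x y : N.points, (x : Plane) ∈ A → (y : Plane) ∈ B →
    f (N.d x y) ≤ g (N.d x y)) : N.pairSum A B f ≤ N.pairSum A B g :=
  ENNReal.tsum_le_tsum fun x => ENNReal.tsum_le_tsum fun y => h _ _ x.2 y.2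

theorem pairSum_add (N : RouteSystem) (A B : Set Plane) (f g : ℝ → ℝ≥0∞) :
    N.pairSum A B (fun t => f t + g t) = N.pairSum A B f + N.pairSum A B g := by
  simp only [pairSum, ENNReal.tsum_add]

theorem pairSum_const_mul (N : RouteSystem) (A B : Set Plane) (c : ℝ≥0∞) (f : ℝ → ℝ≥0∞) :
    N.pairSum A B (fun t => c * f t) = c * N.pairSum A B f := by
  simp only [pairSum, ENNReal.tsum_mul_left]

theorem le_pairSum {x y : N.points} (hx : (x : Plane) ∈ A) (hy : (y : Plane) ∈ B)
    (f : ℝ → ℝ≥0∞) : f (N.d x y) ≤ N.pairSum A B f :=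
  (ENNReal.le_tsum (f := fun y : {y : N.points // (y : Plane) ∈ B} => f (N.d x y.1)) ⟨y, hy⟩).trans
    (ENNReal.le_tsum (f := fun x : {x : N.points // (x : Plane) ∈ A} =>
      ∑' y : {y : N.points // (y : Plane) ∈ B}, f (N.d x.1 y.1)) ⟨x, hx⟩)

theorem tsum_one_subtype (hA : (N.points ∩ A).Finite) :
    ∑' _ : {x : N.points // (x : Plane) ∈ A}, (1 : ℝ≥0∞) = N.count A := by
  have e : {x : N.points // (x : Plane) ∈ A} ≃ (N.points ∩ A : Set Plane) :=
    Equiv.subtypeSubtypeEquivSubtypeInter (fun x => x ∈ N.points) (fun x => x ∈ A)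
  rw [e.tsum_eq (fun _ => (1 : ℝ≥0∞)), count]
  have := hA.fintype
  rw [tsum_fintype, Set.ncard_eq_toFinset_card']
  simp

theorem pairSum_one (hA : Bornology.IsBounded A) (hB : Bornology.IsBounded B) :
    N.pairSum A B (fun _ => 1) = N.count A * N.count B := by
  simp only [pairSum]
  rw [tsum_one_subtype (N.locallyFinite B hB), ← tsum_one_subtype (N.locallyFinite A hA),
    ← ENNReal.tsum_mul_right]
  simp

/-- With `a`, `b` the two counts, `a² b² ≤ a⁴ + b⁴`. Decoupling the sets lets stationarity give a
bound uniform in the translation of `B`. -/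
theorem pairSum_one_sq_le (hA : Bornology.IsBounded A) (hB : Bornology.IsBounded B) :
    N.pairSum A B (fun _ => 1) ^ 2 ≤
      N.pairSum A A (fun _ => 1) ^ 2 + N.pairSum B B (fun _ => 1) ^ 2 := by
  rw [pairSum_one hA hB, pairSum_one hA hA, pairSum_one hB hB]
  norm_cast
  nlinarith [two_mul_le_add_sq (N.count A ^ 2) (N.count B ^ 2)]

/-! ### Measurability -/

theorem measurable_toMeasure : Measurable toMeasure := comap_measurable _

theorem pairSum_eq_lintegral (N : RouteSystem) (hA : MeasurableSet A) (hB : MeasurableSet B)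
    {f : ℝ → ℝ≥0∞} (hf : Measurable f) :
    N.pairSum A B f = ∫⁻ p, {p : Plane × Plane × ℝ | p.1 ∈ A ∧ p.2.1 ∈ B}.indicator
      (fun p => f p.2.2) p ∂N.toMeasure := by
  have hs : MeasurableSet {p : Plane × Plane × ℝ | p.1 ∈ A ∧ p.2.1 ∈ B} :=
    (measurable_fst hA).inter ((measurable_fst.comp measurable_snd) hB)
  have hm : Measurable ({p : Plane × Plane × ℝ | p.1 ∈ A ∧ p.2.1 ∈ B}.indicator
      (fun p => f p.2.2)) := (hf.comp (measurable_snd.comp measurable_snd)).indicator hs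
  rw [toMeasure, lintegral_sum_measure, pairSum_eq_tsum]
  exact tsum_congr fun p => (lintegral_dirac' _ hm).symm

theorem measurable_pairSum (hA : MeasurableSet A) (hB : MeasurableSet B)
    {f : ℝ → ℝ≥0∞} (hf : Measurable f) : Measurable fun N : RouteSystem => N.pairSum A B f := by
  have hs : MeasurableSet {p : Plane × Plane × ℝ | p.1 ∈ A ∧ p.2.1 ∈ B} :=
    (measurable_fst hA).inter ((measurable_fst.comp measurable_snd) hB)
  have hm : Measurable ({p : Plane × Plane × ℝ | p.1 ∈ A ∧ p.2.1 ∈ B}.indicator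
      (fun p => f p.2.2)) := (hf.comp (measurable_snd.comp measurable_snd)).indicator hs
  simp_rw [fun N : RouteSystem => N.pairSum_eq_lintegral hA hB hf]
  exact (Measure.measurable_lintegral hm).comp measurable_toMeasure

theorem toMeasure_ne_zero_iff {s : Set (Plane × Plane × ℝ)} (hs : MeasurableSet s) :
    N.toMeasure s ≠ 0 ↔ ∃ x y : N.points, ((x : Plane), (y : Plane), N.d x y) ∈ s := by
  rw [toMeasure, Measure.sum_apply _ hs, Ne, ENNReal.tsum_eq_zero]
  simp [Measure.dirac_apply' _ hs]

theorem measurableSet_exists {s : Set (Plane × Plane × ℝ)} (hs : MeasurableSet s) :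
    MeasurableSet {N : RouteSystem |
      ∃ x y : N.points, ((x : Plane), (y : Plane), N.d x y) ∈ s} := by
  simp_rw [← toMeasure_ne_zero_iff hs]
  exact ((Measure.measurable_coe hs).comp measurable_toMeasure) (measurableSet_singleton 0).compl

/-- The σ-algebra sees points only through pairs, but every point `x` occurs in the pair `(x, x)`.
-/
theorem measurableSet_disjoint (hA : MeasurableSet A) :
    MeasurableSet {N : RouteSystem | Disjoint N.points A} := by
  have h := (measurableSet_exists (s := {p : Plane × Plane × ℝ | p.1 ∈ A}) (measurable_fst hA)).compl
  convert h using 1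
  ext N
  simp only [Set.disjoint_left, Set.mem_ofPred_eq, Set.mem_compl_iff, not_exists]
  exact ⟨fun h x _ => h x.2, fun h x hx => h ⟨x, hx⟩ ⟨x, hx⟩⟩

theorem measurable_supDist (hA : MeasurableSet A) (hB : MeasurableSet B) :
    Measurable fun N : RouteSystem => N.supDist A B := by
  refine measurable_of_Ioi fun c => ?_
  have h := measurableSet_exists
    (s := {p : Plane × Plane × ℝ | p.1 ∈ A ∧ p.2.1 ∈ B ∧ c < ENNReal.ofReal p.2.2})
    ((measurable_fst hA).inter (((measurable_fst.comp measurable_snd) hB).inter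
      (measurableSet_lt measurable_const
        (ENNReal.measurable_ofReal.comp (measurable_snd.comp measurable_snd)))))
  convert h using 1
  ext N
  exact lt_supDist_iff

theorem measurable_supDist_marker_right (hA : MeasurableSet A) (z : Plane) :
    Measurable fun N : RouteSystem => N.supDist A (N.marker z) := by
  classical
  simp_rw [supDist_marker_right]
  exact Measurable.iSup fun k => Measurable.ite (measurableSet_disjoint (measurableSet_strip _ _))
    (measurable_supDist hA (measurableSet_cell _ _)) measurable_const

theorem measurable_supDist_marker_left (z : Plane) (hB : MeasurableSet B) :
    Measurable fun N : RouteSystem => N.supDist (N.marker z) B := by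
  simp_rw [fun N : RouteSystem => supDist_comm N (N.marker z) B]
  exact measurable_supDist_marker_right hB z

/-- The largest route-length between the markers of `z` and of `w`. -/
noncomputable def markerDist (N : RouteSystem) (z w : Plane) : ℝ≥0∞ := N.supDist (N.marker z) (N.marker w)

theorem measurable_markerDist (z w : Plane) :
    Measurable fun N : RouteSystem => N.markerDist z w := by
  classical
  simp_rw [markerDist, supDist_marker_left]
  exact Measurable.iSup fun k => Measurable.ite (measurableSet_disjoint (measurableSet_strip _ _))
    (measurable_supDist_marker_right (measurableSet_cell _ _) w) measurable_const

theorem markerDist_ne_top (N : RouteSystem) (z w : Plane) : N.markerDist z w ≠ ∞ :=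
  supDist_ne_top (N.finite_points_inter_marker z) (N.finite_points_inter_marker w)

theorem markerDist_translate (v : Plane) (N : RouteSystem) (z w : Plane) :
    (N.translate v).markerDist z w = N.markerDist (z - v) (w - v) := by
  rw [markerDist, supDist_translate, preimage_marker_translate, preimage_marker_translate]
  rfl

end RouteSystem

/-! ### Poisson estimates and the properties of the law. -/

/-- Since `n⁴ / 4! ≤ exp n`, the exponential series at `r * e` dominates. -/
theorem lintegral_natCast_pow_four_poissonMeasure_lt_top (r : ℝ≥0) :
    ∫⁻ n : ℕ, (n : ℝ≥0∞) ^ 4 ∂poissonMeasure r < ∞ := by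
  have hint : Integrable (fun n : ℕ => (n : ℝ) ^ 4) (poissonMeasure r) := by
    rw [integrable_poissonMeasure_iff]
    have hs : Summable fun n : ℕ =>
        (Real.exp (-r) * 24) * ((r * Real.exp 1) ^ n / (n.factorial : ℝ)) :=
      (Real.summable_pow_div_factorial _).mul_left _
    refine hs.of_nonneg_of_le (fun n => by positivity) fun n => ?_
    have h1 : (n : ℝ) ^ 4 ≤ 24 * Real.exp 1 ^ n := by
      have h2 := Real.pow_div_factorial_le_exp (n : ℝ) (Nat.cast_nonneg n) 4
      have h3 : Real.exp (n : ℝ) = Real.exp 1 ^ n := by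
        rw [← Real.exp_nat_mul, mul_one]
      rw [h3, div_le_iff₀ (by positivity)] at h2
      have : ((Nat.factorial 4 : ℕ) : ℝ) = 24 := by norm_num [Nat.factorial]
      rw [this] at h2
      linarith
    rw [Real.norm_of_nonneg (by positivity)]
    calc Real.exp (-r) * r ^ n / n.factorial * (n : ℝ) ^ 4
        ≤ Real.exp (-r) * r ^ n / n.factorial * (24 * Real.exp 1 ^ n) := by gcongr
      _ = _ := by rw [mul_pow]; ring
  have h := hint.2
  rw [hasFiniteIntegral_iff_enorm] at h
  refine lt_of_le_of_lt (lintegral_mono fun n => le_of_eq ?_) h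
  rw [Real.enorm_eq_ofReal (by positivity), ENNReal.ofReal_pow (by positivity),
    ENNReal.ofReal_natCast]

theorem summable_exp_neg_div_four_mul_sq :
    Summable fun k : ℕ => Real.exp (-(k / 4 : ℝ)) * (1 + k : ℝ) ^ 2 := by
  have h0 := Real.summable_pow_mul_exp_neg_nat_mul 0 (r := 1 / 4) (by norm_num)
  have h1 := Real.summable_pow_mul_exp_neg_nat_mul 1 (r := 1 / 4) (by norm_num)
  have h2 := Real.summable_pow_mul_exp_neg_nat_mul 2 (r := 1 / 4) (by norm_num)
  refine ((h0.add (h1.mul_left 2)).add h2).congr fun k => ?_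
  rw [show -(k / 4 : ℝ) = -(1 / 4) * k by ring]
  ring

/-- The properties of the law of a random route system which enter the shape theorem. -/
structure IsShapeLaw (μ : Measure RouteSystem) : Prop where
  invariant : ∀ v : Plane, MeasurePreserving (RouteSystem.translate v) μ μ
  ergodic : ∀ v : Plane, v ≠ 0 → Ergodic (RouteSystem.translate v) μ
  void_le : ∀ (z : Plane) (k : ℕ),
    μ {N | Disjoint N.points (strip z k)} ≤ ENNReal.ofReal (Real.exp (-k))
  moment : ∀ A : Set Plane, MeasurableSet A → Bornology.IsBounded A →
    ∫⁻ N, N.pairSum A A (fun _ => 1) ^ 2 ∂μ < ∞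
  sq_growth : ∀ A B : Set Plane, MeasurableSet A → MeasurableSet B →
    Bornology.IsBounded A → Bornology.IsBounded B → ∃ C : ℝ, 0 ≤ C ∧ ∀ z : Plane,
      ∫⁻ N, N.pairSum A (z +ᵥ B) (fun t => ENNReal.ofReal (t ^ 2)) ∂μ ≤
        ENNReal.ofReal (C * max 1 (‖z‖ ^ 2))

theorem measurable_ofReal_sq : Measurable fun t : ℝ => ENNReal.ofReal (t ^ 2) := by fun_prop

theorem measurableSet_vadd {B : Set Plane} (hB : MeasurableSet B) (z : Plane) :
    MeasurableSet (z +ᵥ B) := hB.const_vadd z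

theorem isShapeLaw_map {Ω : Type*} [MeasurableSpace Ω] {P : Measure Ω}
    {X : Ω → RouteSystem} (hX : Measurable X)
    (hPoisson : IsRateOnePoisson P X) (hErgodic : IsInvariantErgodic P X)
    (hL2 : L2GrowthBound P X) : IsShapeLaw (P.map X) where
  invariant := hErgodic.invariant
  ergodic := hErgodic.ergodic
  void_le z k := by
    have hlaw := hPoisson.law _ (measurableSet_strip z k) (isBounded_strip z k)
    -- The image measure of a map that is not almost everywhere measurable is `0`, which a Poisson
    -- law is not.
    have hae : AEMeasurable (fun ω => (X ω).count (strip z k)) P :=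
      .of_map_ne_zero (by rw [hlaw]; exact IsProbabilityMeasure.ne_zero _)
    rw [Measure.map_apply hX (RouteSystem.measurableSet_disjoint (measurableSet_strip z k))]
    have h0 : P ((fun ω => (X ω).count (strip z k)) ⁻¹' {0}) =
        ENNReal.ofReal (Real.exp (-k)) := by
      rw [← Measure.map_apply_of_aemeasurable hae (measurableSet_singleton 0), hlaw,
        poissonMeasure_singleton, volume_strip]
      simp
    rw [← h0]
    refine measure_mono fun ω hω => ?_
    simp only [Set.mem_preimage, Set.mem_ofPred_eq] at hω
    simp [RouteSystem.count, hω.inter_eq]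
  moment A hA hAb := by
    have hlaw := hPoisson.law A hA hAb
    have hae : AEMeasurable (fun ω => (X ω).count A) P :=
      .of_map_ne_zero (by rw [hlaw]; exact IsProbabilityMeasure.ne_zero _)
    rw [lintegral_map ((RouteSystem.measurable_pairSum hA hA measurable_const).pow_const 2) hX]
    have h := lintegral_natCast_pow_four_poissonMeasure_lt_top (volume A).toNNReal
    rw [← hlaw, lintegral_map' (by fun_prop) hae] at h
    refine lt_of_le_of_lt (lintegral_mono fun ω => le_of_eq ?_) h
    rw [RouteSystem.pairSum_one hAb hAb]
    ring
  sq_growth A B hA hB hAb hBb := by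
    have h := hL2 A B hA hB hAb hBb
    refine ⟨ENNReal.toReal _, ENNReal.toReal_nonneg (a := ⨆ z : Plane,
      (∫⁻ ω, (X ω).pairSum A (z +ᵥ B) (fun t => ENNReal.ofReal (t ^ 2)) ∂P) /
        ENNReal.ofReal (max 1 (‖z‖ ^ 2))), fun z => ?_⟩
    rw [ENNReal.ofReal_mul ENNReal.toReal_nonneg, ENNReal.ofReal_toReal h.ne,
      lintegral_map (RouteSystem.measurable_pairSum hA (measurableSet_vadd hB z)
        measurable_ofReal_sq) hX, ← ENNReal.div_le_iff]
    · exact le_iSup (fun z : Plane =>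
        (∫⁻ ω, (X ω).pairSum A (z +ᵥ B) (fun t => ENNReal.ofReal (t ^ 2)) ∂P) /
          ENNReal.ofReal (max 1 (‖z‖ ^ 2))) z
    · simp
    · exact ENNReal.ofReal_ne_top

/-! ### Linear growth of the mean marker distance. -/

namespace RouteSystem

/-- For each route-length, `t ≤ σ + t² / σ`, and the sum of squares dominates each square. -/
theorem supDist_le_add_pairSum (N : RouteSystem) (A B : Set Plane) {σ : ℝ} (hσ : 0 < σ) :
    N.supDist A B ≤ ENNReal.ofReal σ +
      ENNReal.ofReal σ⁻¹ * N.pairSum A B (fun t => ENNReal.ofReal (t ^ 2)) := by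
  rw [supDist_le_iff]
  intro x y hx hy
  have h : N.d x y ≤ σ + σ⁻¹ * N.d x y ^ 2 := by
    rw [inv_mul_eq_div, ← sub_le_iff_le_add', le_div_iff₀ hσ]
    nlinarith [sq_nonneg (N.d x y - σ), N.d_nonneg x y]
  calc ENNReal.ofReal (N.d x y) ≤ ENNReal.ofReal (σ + σ⁻¹ * N.d x y ^ 2) :=
        ENNReal.ofReal_le_ofReal h
    _ = ENNReal.ofReal σ + ENNReal.ofReal σ⁻¹ * ENNReal.ofReal (N.d x y ^ 2) := by
        rw [ENNReal.ofReal_add hσ.le (by positivity), ENNReal.ofReal_mul (by positivity)]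
    _ ≤ _ := by
        gcongr
        exact le_pairSum hx hy fun t => ENNReal.ofReal (t ^ 2)

/-- A supremum over pairs of cells is at most the sum. The truncation level may vary with the pair;
the void event is kept only where it is needed, on the constant term. -/
theorem markerDist_le_tsum (N : RouteSystem) (z w : Plane) (σ : ℕ → ℕ → ℝ)
    (hσ : ∀ k l, 0 < σ k l) :
    N.markerDist z w ≤ ∑' k : ℕ, ∑' l : ℕ,
      (({N : RouteSystem | Disjoint N.points (strip z k)} ∩
          {N | Disjoint N.points (strip w l)}).indicator
          (fun _ => ENNReal.ofReal (σ k l)) N +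
        ENNReal.ofReal (σ k l)⁻¹ *
          N.pairSum (cell z k) (cell w l) (fun t => ENNReal.ofReal (t ^ 2))) := by
  classical
  rw [markerDist, supDist_marker_left]
  refine iSup_le fun k => le_trans ?_ (ENNReal.le_tsum k)
  split_ifs with hk
  · rw [supDist_marker_right]
    refine iSup_le fun l => le_trans ?_ (ENNReal.le_tsum l)
    split_ifs with hl
    · have hmem : N ∈ {N : RouteSystem | Disjoint N.points (strip z k)} ∩
          {N | Disjoint N.points (strip w l)} := ⟨hk, hl⟩
      rw [Set.indicator_of_mem hmem]
      exact supDist_le_add_pairSum N _ _ (hσ k l)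
    · exact zero_le
  · exact zero_le

end RouteSystem

namespace IsShapeLaw

variable {μ : Measure RouteSystem}

theorem lintegral_pairSum_translate (h : IsShapeLaw μ) {A B : Set Plane} (hA : MeasurableSet A)
    (hB : MeasurableSet B) {f : ℝ → ℝ≥0∞} (hf : Measurable f) (v : Plane) (p : ℕ) :
    ∫⁻ N, N.pairSum ((fun x => x + v) ⁻¹' A) ((fun x => x + v) ⁻¹' B) f ^ p ∂μ =
      ∫⁻ N, N.pairSum A B f ^ p ∂μ := by
  rw [← (h.invariant v).lintegral_comp ((RouteSystem.measurable_pairSum hA hB hf).pow_const p)]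
  simp_rw [RouteSystem.pairSum_translate]

/-- By stationarity one `L²` bound, for two copies of the unit square, serves all pairs of cells. -/
theorem exists_lintegral_pairSum_cell_le (h : IsShapeLaw μ) : ∃ C : ℝ, 0 ≤ C ∧
    ∀ (z w : Plane) (k l : ℕ),
      ∫⁻ N, N.pairSum (cell z k) (cell w l) (fun t => ENNReal.ofReal (t ^ 2)) ∂μ ≤
        ENNReal.ofReal (C * ((1 + ‖w - z‖) * ((1 + k) * (1 + l))) ^ 2) := by
  obtain ⟨C, hC, hb⟩ := h.sq_growth (strip 0 1) (strip 0 1) (measurableSet_strip _ _)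
    (measurableSet_strip _ _) (isBounded_strip _ _) (isBounded_strip _ _)
  refine ⟨C, hC, fun z w k l => ?_⟩
  set e : Plane := EuclideanSpace.single 0 1 with he
  have hshift := h.lintegral_pairSum_translate (measurableSet_cell z k) (measurableSet_cell w l)
    measurable_ofReal_sq (z + (k : ℝ) • e) 1
  simp only [pow_one] at hshift
  rw [← hshift]
  have e1 : (fun x : Plane => x + (z + (k : ℝ) • e)) ⁻¹' cell z k = strip 0 1 := by
    rw [cell, preimage_add_right_strip, sub_self]
  have e2 : (fun x : Plane => x + (z + (k : ℝ) • e)) ⁻¹' cell w l =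
      (w + (l : ℝ) • e - (z + (k : ℝ) • e)) +ᵥ strip 0 1 := by
    rw [cell, preimage_add_right_strip, vadd_strip, add_zero]
  rw [e1, e2]
  refine (hb _).trans (ENNReal.ofReal_le_ofReal ?_)
  have hn : ‖w + (l : ℝ) • e - (z + (k : ℝ) • e)‖ ≤ (1 + ‖w - z‖) * ((1 + k) * (1 + l)) := by
    have e3 : w + (l : ℝ) • e - (z + (k : ℝ) • e) = (w - z) + ((l : ℝ) • e - (k : ℝ) • e) := by
      abel
    have hne : ‖e‖ = 1 := by simp [he]
    have h1 : ‖(l : ℝ) • e - (k : ℝ) • e‖ ≤ l + k := by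
      refine (norm_sub_le _ _).trans ?_
      simp [norm_smul, hne]
    rw [e3]
    refine (norm_add_le _ _).trans ?_
    have hp1 : 0 ≤ ‖w - z‖ * (k + l + k * l : ℝ) := by positivity
    have hp2 : (0 : ℝ) ≤ k * l := by positivity
    nlinarith
  have h1 : (1 : ℝ) ≤ (1 + ‖w - z‖) * ((1 + k) * (1 + l)) := by
    have : (1 : ℝ) ≤ 1 + ‖w - z‖ := by linarith [norm_nonneg (w - z)]
    have h2 : (1 : ℝ) ≤ 1 + k := by linarith [Nat.cast_nonneg (α := ℝ) k]
    have h3 : (1 : ℝ) ≤ 1 + l := by linarith [Nat.cast_nonneg (α := ℝ) l]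
    exact one_le_mul_of_one_le_of_one_le this (one_le_mul_of_one_le_of_one_le h2 h3)
  gcongr
  refine max_le (one_le_pow₀ h1) ?_
  gcongr

/-- The smaller of `exp (-k)` and `exp (-l)` is at most their geometric mean; the strips may
overlap, so the probabilities cannot simply be multiplied. -/
theorem measure_disjoint_inter_le (h : IsShapeLaw μ) (z w : Plane) (k l : ℕ) :
    μ ({N | Disjoint N.points (strip z k)} ∩ {N | Disjoint N.points (strip w l)}) ≤
      ENNReal.ofReal (Real.exp (-((k + l) / 2))) := by
  rcases le_total k l with hkl | hkl
  · refine (measure_mono Set.inter_subset_right).trans ((h.void_le w l).trans ?_)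
    have : (k : ℝ) ≤ l := by exact_mod_cast hkl
    gcongr
    linarith
  · refine (measure_mono Set.inter_subset_left).trans ((h.void_le z k).trans ?_)
    have : (l : ℝ) ≤ k := by exact_mod_cast hkl
    gcongr
    linarith

theorem exists_lintegral_markerDist_le (h : IsShapeLaw μ) : ∃ C : ℝ, 0 ≤ C ∧ ∀ z w : Plane,
    ∫⁻ N, N.markerDist z w ∂μ ≤ ENNReal.ofReal (C * (1 + ‖w - z‖)) := by
  obtain ⟨C, hC, hcell⟩ := h.exists_lintegral_pairSum_cell_le
  set b : ℕ → ℝ := fun k => Real.exp (-(k / 4 : ℝ)) * (1 + k : ℝ) ^ 2 with hb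
  have hb0 : ∀ k, 0 ≤ b k := fun k => by positivity
  have hbs : ∑' k, ENNReal.ofReal (b k) ≠ ∞ :=
    summable_exp_neg_div_four_mul_sq.tsum_ofReal_ne_top
  set T := ∑' k, ENNReal.ofReal (b k) with hT
  refine ⟨(1 + C) * T.toReal ^ 2, by positivity, fun z w => ?_⟩
  set R : ℝ := 1 + ‖w - z‖ with hR
  have hR0 : 0 < R := by positivity
  -- Balances the two terms. The void probability `exp (-(k + l) / 2)` leaves `R * exp (-(k + l) /
  -- 4)`; division of the square bound, of order `R²`, by `σ` leaves the same up to a polynomial in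
  -- `k`, `l`. Both are linear in `R` and summable.
  set σ : ℕ → ℕ → ℝ := fun k l => R * Real.exp ((k + l) / 4) with hσ
  have hσ0 : ∀ k l, 0 < σ k l := fun k l => by positivity
  have hmE : ∀ k l : ℕ, MeasurableSet ({N : RouteSystem | Disjoint N.points (strip z k)} ∩
      {N | Disjoint N.points (strip w l)}) := fun k l =>
    (RouteSystem.measurableSet_disjoint (measurableSet_strip _ _)).inter
      (RouteSystem.measurableSet_disjoint (measurableSet_strip _ _))
  have hmP : ∀ k l : ℕ, Measurable fun N : RouteSystem =>
      N.pairSum (cell z k) (cell w l) (fun t => ENNReal.ofReal (t ^ 2)) := fun k l =>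
    RouteSystem.measurable_pairSum (measurableSet_cell _ _) (measurableSet_cell _ _)
      measurable_ofReal_sq
  have hterm : ∀ k l : ℕ, ∫⁻ N, (({N : RouteSystem | Disjoint N.points (strip z k)} ∩
          {N | Disjoint N.points (strip w l)}).indicator
          (fun _ => ENNReal.ofReal (σ k l)) N +
        ENNReal.ofReal (σ k l)⁻¹ *
          N.pairSum (cell z k) (cell w l) (fun t => ENNReal.ofReal (t ^ 2))) ∂μ ≤
      ENNReal.ofReal (R * (1 + C)) * (ENNReal.ofReal (b k) * ENNReal.ofReal (b l)) := by
    intro k l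
    rw [lintegral_add_left (measurable_const.indicator (hmE k l)),
      lintegral_indicator_const (hmE k l), lintegral_const_mul _ (hmP k l)]
    have he1 : Real.exp ((k + l) / 4 : ℝ) * Real.exp (-((k + l) / 2)) =
        Real.exp (-(k / 4 : ℝ)) * Real.exp (-(l / 4 : ℝ)) := by
      rw [← Real.exp_add, ← Real.exp_add]; congr 1; ring
    have he2 : (Real.exp ((k + l) / 4 : ℝ))⁻¹ =
        Real.exp (-(k / 4 : ℝ)) * Real.exp (-(l / 4 : ℝ)) := by
      rw [← Real.exp_neg, ← Real.exp_add]; congr 1; ring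
    calc ENNReal.ofReal (σ k l) * μ ({N | Disjoint N.points (strip z k)} ∩
            {N | Disjoint N.points (strip w l)}) + ENNReal.ofReal (σ k l)⁻¹ *
          ∫⁻ N, N.pairSum (cell z k) (cell w l) (fun t => ENNReal.ofReal (t ^ 2)) ∂μ
        ≤ ENNReal.ofReal (σ k l) * ENNReal.ofReal (Real.exp (-((k + l) / 2))) +
          ENNReal.ofReal (σ k l)⁻¹ *
            ENNReal.ofReal (C * (R * ((1 + k) * (1 + l))) ^ 2) := by
          gcongr
          · exact h.measure_disjoint_inter_le z w k l
          · exact hcell z w k l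
      _ = ENNReal.ofReal (R * (Real.exp (-(k / 4 : ℝ)) * Real.exp (-(l / 4 : ℝ))) *
            (1 + C * ((1 + k) ^ 2 * (1 + l) ^ 2))) := by
          rw [← ENNReal.ofReal_mul (hσ0 k l).le,
            ← ENNReal.ofReal_mul (inv_nonneg.2 (hσ0 k l).le),
            ← ENNReal.ofReal_add (by positivity) (by positivity)]
          congr 1
          simp only [hσ]
          rw [mul_assoc, he1, mul_inv, he2]
          field_simp
      _ ≤ ENNReal.ofReal (R * (1 + C) * (b k * b l)) := by
          apply ENNReal.ofReal_le_ofReal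
          have h1 : (1 : ℝ) ≤ (1 + k) ^ 2 * (1 + l) ^ 2 :=
            one_le_mul_of_one_le_of_one_le
              (one_le_pow₀ (by linarith [Nat.cast_nonneg (α := ℝ) k]))
              (one_le_pow₀ (by linarith [Nat.cast_nonneg (α := ℝ) l]))
          calc R * (Real.exp (-(k / 4 : ℝ)) * Real.exp (-(l / 4 : ℝ))) *
                (1 + C * ((1 + k) ^ 2 * (1 + l) ^ 2))
              ≤ R * (Real.exp (-(k / 4 : ℝ)) * Real.exp (-(l / 4 : ℝ))) *
                ((1 + k) ^ 2 * (1 + l) ^ 2 + C * ((1 + k) ^ 2 * (1 + l) ^ 2)) := by gcongr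
            _ = _ := by simp only [hb]; ring
      _ = _ := by
          rw [ENNReal.ofReal_mul (by positivity), ENNReal.ofReal_mul (hb0 k)]
  calc ∫⁻ N, N.markerDist z w ∂μ
      ≤ ∫⁻ N, ∑' k : ℕ, ∑' l : ℕ,
        (({N : RouteSystem | Disjoint N.points (strip z k)} ∩
            {N | Disjoint N.points (strip w l)}).indicator
            (fun _ => ENNReal.ofReal (σ k l)) N +
          ENNReal.ofReal (σ k l)⁻¹ *
            N.pairSum (cell z k) (cell w l) (fun t => ENNReal.ofReal (t ^ 2))) ∂μ :=
        lintegral_mono fun N => N.markerDist_le_tsum z w σ hσ0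
    _ = ∑' k : ℕ, ∑' l : ℕ, ∫⁻ N,
        (({N : RouteSystem | Disjoint N.points (strip z k)} ∩
            {N | Disjoint N.points (strip w l)}).indicator
            (fun _ => ENNReal.ofReal (σ k l)) N +
          ENNReal.ofReal (σ k l)⁻¹ *
            N.pairSum (cell z k) (cell w l) (fun t => ENNReal.ofReal (t ^ 2))) ∂μ := by
        have hm : ∀ k l : ℕ, Measurable fun N =>
            (({N : RouteSystem | Disjoint N.points (strip z k)} ∩
              {N | Disjoint N.points (strip w l)}).indicator
              (fun _ => ENNReal.ofReal (σ k l)) N +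
            ENNReal.ofReal (σ k l)⁻¹ *
              N.pairSum (cell z k) (cell w l) (fun t => ENNReal.ofReal (t ^ 2))) := fun k l =>
          (measurable_const.indicator (hmE k l)).add ((hmP k l).const_mul _)
        rw [lintegral_tsum fun k => (Measurable.tsum fun l => hm k l).aemeasurable]
        exact tsum_congr fun k => lintegral_tsum fun l => (hm k l).aemeasurable
    _ ≤ ∑' k : ℕ, ∑' l : ℕ,
        ENNReal.ofReal (R * (1 + C)) * (ENNReal.ofReal (b k) * ENNReal.ofReal (b l)) :=
        ENNReal.tsum_le_tsum fun k => ENNReal.tsum_le_tsum fun l => hterm k l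
    _ = ENNReal.ofReal (R * (1 + C)) * (T * T) := by
        simp_rw [ENNReal.tsum_mul_left, ENNReal.tsum_mul_right]
        rfl
    _ = ENNReal.ofReal ((1 + C) * T.toReal ^ 2 * R) := by
        conv_lhs => rw [← ENNReal.ofReal_toReal hbs]
        rw [← ENNReal.ofReal_mul ENNReal.toReal_nonneg, ← ENNReal.ofReal_mul (by positivity)]
        congr 1
        ring

theorem ae_nonempty_marker (h : IsShapeLaw μ) (z : Plane) :
    ∀ᵐ N ∂μ, (N.points ∩ N.marker z).Nonempty := by
  have hnull : μ {N : RouteSystem | ∀ k : ℕ, Disjoint N.points (strip z k)} = 0 := by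
    have hlim : Tendsto (fun k : ℕ => ENNReal.ofReal (Real.exp (-k))) atTop (𝓝 0) := by
      rw [← ENNReal.ofReal_zero]
      exact ENNReal.tendsto_ofReal (Real.tendsto_exp_neg_atTop_nhds_zero.comp
        tendsto_natCast_atTop_atTop)
    refine le_antisymm (ge_of_tendsto' hlim fun k => ?_) zero_le
    refine le_trans (measure_mono ?_) (h.void_le z k)
    exact fun N hN => hN k
  filter_upwards [measure_eq_zero_iff_ae_notMem.1 hnull] with N hN
  simp only [not_forall] at hN
  obtain ⟨k, hk⟩ := hN
  exact RouteSystem.nonempty_points_inter_marker hk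

theorem exists_isErgodicSubadditive (h : IsShapeLaw μ) : ∃ C : ℝ,
    IsErgodicSubadditive μ RouteSystem.translate
      (fun z w N => (N.markerDist z w).toReal) C := by
  obtain ⟨C, hC, hb⟩ := h.exists_lintegral_markerDist_le
  refine ⟨C, h.invariant, h.ergodic, fun v z w N => ?_, fun _ _ _ => ENNReal.toReal_nonneg,
    fun z w N => ?_, fun z w y => ?_, fun z w => ?_, fun z w => ?_⟩
  · simp only [RouteSystem.markerDist_translate]
  · simp only [RouteSystem.markerDist, N.supDist_comm (N.marker z)]
  · filter_upwards [h.ae_nonempty_marker w] with N hN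
    rw [← ENNReal.toReal_add (N.markerDist_ne_top _ _) (N.markerDist_ne_top _ _)]
    exact ENNReal.toReal_mono
      (ENNReal.add_ne_top.2 ⟨N.markerDist_ne_top _ _, N.markerDist_ne_top _ _⟩)
      (RouteSystem.supDist_triangle hN)
  · exact integrable_toReal_of_lintegral_ne_top
      (RouteSystem.measurable_markerDist z w).aemeasurable
      (ne_top_of_le_ne_top ENNReal.ofReal_ne_top (hb z w))
  · rw [integral_toReal (RouteSystem.measurable_markerDist z w).aemeasurable
      (ae_of_all _ fun N => (N.markerDist_ne_top z w).lt_top)]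
    exact ENNReal.toReal_le_of_le_ofReal (by positivity) (hb z w)

end IsShapeLaw

/-! ### From marker distances to all pairs of points. -/

theorem tendsto_measure_ofReal_lt {α : Type*} [MeasurableSpace α] {μ : Measure α}
    [IsFiniteMeasure μ] {f : α → ℝ≥0∞} (hf : Measurable f) (hf' : ∀ x, f x ≠ ∞) :
    Tendsto (fun r : ℝ => μ {x | ENNReal.ofReal r < f x}) atTop (𝓝 0) := by
  have h := tendsto_measure_iInter_atTop (μ := μ) (s := fun r : ℝ => {x | ENNReal.ofReal r < f x})
    (fun r => (measurableSet_lt measurable_const hf).nullMeasurableSet)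
    (fun r s hrs x hx => lt_of_le_of_lt (ENNReal.ofReal_le_ofReal hrs) hx)
    ⟨0, measure_ne_top _ _⟩
  have he : ⋂ r : ℝ, {x | ENNReal.ofReal r < f x} = ∅ := by
    ext x
    simp only [Set.mem_iInter, Set.mem_ofPred_eq, Set.mem_empty_iff_false, iff_false, not_forall,
      not_lt]
    exact ⟨(f x).toReal, by rw [ENNReal.ofReal_toReal (hf' x)]⟩
  rwa [he, measure_empty] at h

theorem le_ofReal_mul_sq_add (x : ℝ≥0∞) {a : ℝ} (ha : 0 < a) :
    x ≤ ENNReal.ofReal a * x ^ 2 + ENNReal.ofReal a⁻¹ := by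
  rcases eq_or_ne x ∞ with rfl | hx
  · simp [ha]
  · obtain ⟨y, hy, rfl⟩ : ∃ y : ℝ, 0 ≤ y ∧ ENNReal.ofReal y = x :=
      ⟨x.toReal, ENNReal.toReal_nonneg, ENNReal.ofReal_toReal hx⟩
    rw [← ENNReal.ofReal_pow hy, ← ENNReal.ofReal_mul ha.le,
      ← ENNReal.ofReal_add (by positivity) (by positivity)]
    apply ENNReal.ofReal_le_ofReal
    have h1 : a * y ^ 2 + a⁻¹ - y = ((a * y - 1) ^ 2 + a * y) / a := by
      field_simp
      ring
    have h2 : 0 ≤ ((a * y - 1) ^ 2 + a * y) / a := by positivity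
    linarith

namespace RouteSystem

variable {N : RouteSystem} {A B : Set Plane}

/-- Above, route `x` to `y` through one point of each marker. Below, route every pair of marker
points through `x` and `y`, which bounds their maximum. Each costs `2 * η`, and the centring one
more. -/
theorem abs_d_sub_markerDist_le {z w : Plane} {η c : ℝ} (hη : 0 ≤ η)
    (hz : (N.points ∩ N.marker z).Nonempty) (hw : (N.points ∩ N.marker w).Nonempty)
    (hA : N.supDist A (N.marker z) ≤ ENNReal.ofReal η)
    (hB : N.supDist (N.marker w) B ≤ ENNReal.ofReal η)
    (hc : |(N.markerDist z w).toReal - c| ≤ η)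
    (x y : N.points) (hx : (x : Plane) ∈ A) (hy : (y : Plane) ∈ B) :
    |N.d x y - c| ≤ 3 * η := by
  have hxA : ∀ ξ : N.points, (ξ : Plane) ∈ N.marker z → N.d x ξ ≤ η := fun ξ hξ =>
    (ENNReal.ofReal_le_ofReal_iff hη).1 ((le_supDist hx hξ).trans hA)
  have hyB : ∀ ξ : N.points, (ξ : Plane) ∈ N.marker w → N.d ξ y ≤ η := fun ξ hξ =>
    (ENNReal.ofReal_le_ofReal_iff hη).1 ((le_supDist hξ hy).trans hB)
  have hM := N.markerDist_ne_top z w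
  have h1 : N.d x y ≤ (N.markerDist z w).toReal + 2 * η := by
    obtain ⟨ξ, hξ, hξz⟩ := hz
    obtain ⟨ζ, hζ, hζw⟩ := hw
    have h2 : N.d ⟨ξ, hξ⟩ ⟨ζ, hζ⟩ ≤ (N.markerDist z w).toReal :=
      (ENNReal.ofReal_le_iff_le_toReal hM).1 (le_supDist hξz hζw)
    linarith [N.d_triangle x ⟨ξ, hξ⟩ y, N.d_triangle ⟨ξ, hξ⟩ ⟨ζ, hζ⟩ y, hxA ⟨ξ, hξ⟩ hξz,
      hyB ⟨ζ, hζ⟩ hζw]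
  have h2 : (N.markerDist z w).toReal ≤ N.d x y + 2 * η := by
    have hnn : 0 ≤ N.d x y + 2 * η := by linarith [N.d_nonneg x y]
    refine ENNReal.toReal_le_of_le_ofReal hnn (supDist_le_iff.2 fun ξ ζ hξ hζ => ?_)
    apply ENNReal.ofReal_le_ofReal
    have h3 := hxA ξ hξ
    rw [N.d_symm] at h3
    have h4 := hyB ζ hζ
    rw [N.d_symm] at h4
    linarith [N.d_triangle ξ x ζ, N.d_triangle x y ζ]
  rw [abs_le] at hc ⊢
  constructor <;> linarith [hc.1, hc.2]

open Classical in
-- In the exceptional case, `|t - c| ≤ (δ / r) * (t - c)² + r / δ`: the square carries a small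
-- factor, and the large constant `δ⁻¹` appears only under `p`.
theorem S_le {r δ K c : ℝ} (hr : 0 < r) (hδ : 0 < δ) (hK : |c| ≤ K * r) (p : Prop)
    (h : ¬p → ∀ x y : N.points, (x : Plane) ∈ A → (y : Plane) ∈ B →
      |N.d x y - c| ≤ 3 * (δ * r)) :
    N.S A B c ≤ ENNReal.ofReal r *
      (ENNReal.ofReal (δ * (3 + 2 * K ^ 2)) * N.pairSum A B (fun _ => 1) +
        ENNReal.ofReal (2 * δ / r ^ 2) * N.pairSum A B (fun t => ENNReal.ofReal (t ^ 2)) +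
        (if p then ENNReal.ofReal δ⁻¹ else 0) * N.pairSum A B (fun _ => 1)) := by
  rw [← pairSum_const_mul, ← pairSum_const_mul, ← pairSum_const_mul, ← pairSum_add,
    ← pairSum_add, ← pairSum_const_mul]
  refine pairSum_mono fun x y hx hy => ?_
  set t := N.d x y with ht
  have hif : (if p then ENNReal.ofReal δ⁻¹ else 0) = ENNReal.ofReal (if p then δ⁻¹ else 0) := by
    split_ifs <;> simp
  have hif0 : 0 ≤ (if p then δ⁻¹ else 0 : ℝ) := by split_ifs <;> positivity
  rw [mul_one, mul_one, hif, ← ENNReal.ofReal_mul (by positivity),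
    ← ENNReal.ofReal_add (by positivity) (by positivity),
    ← ENNReal.ofReal_add (by positivity) hif0, ← ENNReal.ofReal_mul hr.le]
  apply ENNReal.ofReal_le_ofReal
  have hc2 : c ^ 2 ≤ K ^ 2 * r ^ 2 := by
    rw [← mul_pow, ← sq_abs c]
    gcongr
  by_cases hp : p
  · simp only [hp, if_true]
    have h1 : |t - c| ≤ δ / r * (t - c) ^ 2 + r * δ⁻¹ := by
      rw [← sq_abs (t - c)]
      set s := |t - c| with hs
      have hs0 : 0 ≤ s := abs_nonneg _
      have h2 : δ / r * s ^ 2 + r * δ⁻¹ - s = ((δ * s - r) ^ 2 + δ * s * r) / (δ * r) := by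
        field_simp
        ring
      have h3 : 0 ≤ ((δ * s - r) ^ 2 + δ * s * r) / (δ * r) := by positivity
      linarith
    have h2 : δ / r * (t - c) ^ 2 ≤ δ / r * (2 * t ^ 2 + 2 * (K ^ 2 * r ^ 2)) := by
      gcongr
      nlinarith [sq_nonneg (t + c)]
    have h3 : r * (δ * (3 + 2 * K ^ 2) + 2 * δ / r ^ 2 * t ^ 2 + δ⁻¹) =
        δ / r * (2 * t ^ 2 + 2 * (K ^ 2 * r ^ 2)) + r * δ⁻¹ + 3 * δ * r := by
      field_simp
      ring
    rw [h3]
    have : 0 < 3 * δ * r := by positivity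
    linarith
  · simp only [hp, if_false, add_zero]
    refine (h hp x y hx hy).trans ?_
    have h1 : 0 ≤ 2 * δ / r ^ 2 * t ^ 2 := by positivity
    have h2 : 0 ≤ δ * (2 * K ^ 2) := by positivity
    nlinarith

end RouteSystem

namespace IsShapeLaw

variable {μ : Measure RouteSystem}

theorem measurable_supDist_marker_left_translate {B : Set Plane} (hB : MeasurableSet B)
    (z : Plane) : Measurable fun N : RouteSystem => N.supDist (N.marker z) (z +ᵥ B) :=
  RouteSystem.measurable_supDist_marker_left z (measurableSet_vadd hB z)

theorem measure_supDist_marker_left (h : IsShapeLaw μ) {B : Set Plane} (hB : MeasurableSet B)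
    (z : Plane) (c : ℝ≥0∞) :
    μ {N | c < N.supDist (N.marker z) (z +ᵥ B)} = μ {N | c < N.supDist (N.marker 0) B} := by
  rw [← (h.invariant z).measure_preimage (measurableSet_lt measurable_const
    (measurable_supDist_marker_left_translate hB z)).nullMeasurableSet]
  congr 1
  ext N
  simp only [Set.mem_preimage, Set.mem_ofPred_eq]
  rw [RouteSystem.supDist_translate, RouteSystem.preimage_marker_translate, sub_self]
  have : (fun x => x + z) ⁻¹' (z +ᵥ B) = B := by
    ext x
    rw [Set.mem_preimage, Set.mem_vadd_set_iff_neg_vadd_mem]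
    simp
  rw [this]

theorem lintegral_pairSum_one_vadd (h : IsShapeLaw μ) {B : Set Plane} (hB : MeasurableSet B)
    (z : Plane) : ∫⁻ N, N.pairSum (z +ᵥ B) (z +ᵥ B) (fun _ => 1) ^ 2 ∂μ =
      ∫⁻ N, N.pairSum B B (fun _ => 1) ^ 2 ∂μ := by
  rw [← h.lintegral_pairSum_translate (measurableSet_vadd hB z) (measurableSet_vadd hB z)
    measurable_const z 2]
  have : (fun x => x + z) ⁻¹' (z +ᵥ B) = B := by
    ext x
    rw [Set.mem_preimage, Set.mem_vadd_set_iff_neg_vadd_mem]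
    simp
  rw [this]

/-- The second moment of the number of pairs of points in `A × (z + B)` is bounded in `z`. -/
theorem exists_lintegral_pairSum_one_sq_le (h : IsShapeLaw μ) {A B : Set Plane}
    (hA : MeasurableSet A) (hB : MeasurableSet B) (hAb : Bornology.IsBounded A)
    (hBb : Bornology.IsBounded B) : ∃ M : ℝ≥0∞, M ≠ ∞ ∧ ∀ z : Plane,
      ∫⁻ N, N.pairSum A (z +ᵥ B) (fun _ => 1) ^ 2 ∂μ ≤ M := by
  refine ⟨∫⁻ N, N.pairSum A A (fun _ => 1) ^ 2 ∂μ +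
    ∫⁻ N, N.pairSum B B (fun _ => 1) ^ 2 ∂μ,
    ENNReal.add_ne_top.2 ⟨(h.moment A hA hAb).ne, (h.moment B hB hBb).ne⟩, fun z => ?_⟩
  rw [← h.lintegral_pairSum_one_vadd hB z, ← lintegral_add_left
    ((RouteSystem.measurable_pairSum hA hA measurable_const).pow_const 2)]
  exact lintegral_mono fun N => RouteSystem.pairSum_one_sq_le hAb (hBb.vadd z)

/-- The bound on `E S(A, z + B; c)` outside an exceptional event `G`, on the complement of which
all route-lengths are close to `c`. -/
theorem lintegral_S_div_le {A B : Set Plane} (hA : MeasurableSet A)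
    (hB : MeasurableSet B) {M : ℝ≥0∞} [IsProbabilityMeasure μ]
    (hM : ∫⁻ N, N.pairSum A B (fun _ => 1) ^ 2 ∂μ ≤ M) {C r δ K c : ℝ} (hr : 0 < r)
    (hC : ∫⁻ N, N.pairSum A B (fun t => ENNReal.ofReal (t ^ 2)) ∂μ ≤ ENNReal.ofReal (C * r ^ 2))
    (hδ : 0 < δ) (hK : |c| ≤ K * r) {G : Set RouteSystem} (hG : MeasurableSet G)
    (hGc : ∀ᵐ N : RouteSystem ∂μ, N ∉ G → ∀ x y : N.points, (x : Plane) ∈ A → (y : Plane) ∈ B →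
      |N.d x y - c| ≤ 3 * (δ * r)) :
    (∫⁻ N, N.S A B c ∂μ) / ENNReal.ofReal r ≤
      ENNReal.ofReal δ * (ENNReal.ofReal (3 + 2 * K ^ 2) * (M + 1) + ENNReal.ofReal (2 * C) + M) +
        ENNReal.ofReal (δ⁻¹ ^ 3) * μ G := by
  classical
  have hn : Measurable fun N : RouteSystem => N.pairSum A B (fun _ => 1) :=
    RouteSystem.measurable_pairSum hA hB measurable_const
  have hQ : Measurable fun N : RouteSystem =>
      N.pairSum A B (fun t => ENNReal.ofReal (t ^ 2)) :=
    RouteSystem.measurable_pairSum hA hB measurable_ofReal_sq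
  have hr' : ENNReal.ofReal r ≠ 0 := by simpa using hr
  have h1 : ∫⁻ N, N.pairSum A B (fun _ => 1) ∂μ ≤ M + 1 := by
    calc ∫⁻ N, N.pairSum A B (fun _ => 1) ∂μ
        ≤ ∫⁻ N, (N.pairSum A B (fun _ => 1) ^ 2 + 1) ∂μ := by
          refine lintegral_mono fun N => ?_
          have := le_ofReal_mul_sq_add (N.pairSum A B fun _ => 1) one_pos
          simpa using this
      _ ≤ M + 1 := by
          rw [lintegral_add_right _ measurable_const]
          simpa using hM
  have h2 : ∫⁻ N, (if N ∈ G then ENNReal.ofReal δ⁻¹ else 0) * N.pairSum A B (fun _ => 1) ∂μ ≤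
      ENNReal.ofReal δ * M + ENNReal.ofReal (δ⁻¹ ^ 3) * μ G := by
    calc ∫⁻ N, (if N ∈ G then ENNReal.ofReal δ⁻¹ else 0) * N.pairSum A B (fun _ => 1) ∂μ
        ≤ ∫⁻ N, (ENNReal.ofReal δ * N.pairSum A B (fun _ => 1) ^ 2 +
            G.indicator (fun _ => ENNReal.ofReal (δ⁻¹ ^ 3)) N) ∂μ := by
          refine lintegral_mono fun N => ?_
          by_cases hN : N ∈ G
          · simp only [hN, if_true, Set.indicator_of_mem]
            -- With weight `δ²`, the factor `δ⁻¹` turns the square into a term of order `δ`; the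
            -- price `δ⁻¹ ^ 3` multiplies only the measure of `G`.
            have := le_ofReal_mul_sq_add (N.pairSum A B fun _ => 1)
              (show (0 : ℝ) < δ ^ 2 by positivity)
            calc ENNReal.ofReal δ⁻¹ * N.pairSum A B (fun _ => 1)
                ≤ ENNReal.ofReal δ⁻¹ * (ENNReal.ofReal (δ ^ 2) *
                    N.pairSum A B (fun _ => 1) ^ 2 + ENNReal.ofReal (δ ^ 2)⁻¹) := by gcongr
              _ = _ := by
                have e1 : δ⁻¹ * δ ^ 2 = δ := by field_simp
                have e2 : δ⁻¹ * (δ ^ 2)⁻¹ = δ⁻¹ ^ 3 := by field_simp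
                rw [mul_add, ← mul_assoc, ← ENNReal.ofReal_mul (by positivity),
                  ← ENNReal.ofReal_mul (by positivity), e1, e2]
          · simp [hN]
      _ ≤ _ := by
          rw [lintegral_add_right _ (measurable_const.indicator hG),
            lintegral_indicator_const hG, lintegral_const_mul _ (hn.pow_const 2)]
          gcongr
  have h3 : ENNReal.ofReal (2 * δ / r ^ 2) *
      ∫⁻ N, N.pairSum A B (fun t => ENNReal.ofReal (t ^ 2)) ∂μ ≤
        ENNReal.ofReal δ * ENNReal.ofReal (2 * C) := by
    calc _ ≤ ENNReal.ofReal (2 * δ / r ^ 2) * ENNReal.ofReal (C * r ^ 2) := by gcongr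
      _ = _ := by
        rw [← ENNReal.ofReal_mul (by positivity), ← ENNReal.ofReal_mul hδ.le]
        congr 1
        field_simp
  rw [ENNReal.div_le_iff hr' ENNReal.ofReal_ne_top, mul_comm]
  calc ∫⁻ N, N.S A B c ∂μ
      ≤ ∫⁻ N, ENNReal.ofReal r *
        (ENNReal.ofReal (δ * (3 + 2 * K ^ 2)) * N.pairSum A B (fun _ => 1) +
          ENNReal.ofReal (2 * δ / r ^ 2) * N.pairSum A B (fun t => ENNReal.ofReal (t ^ 2)) +
          (if N ∈ G then ENNReal.ofReal δ⁻¹ else 0) * N.pairSum A B (fun _ => 1)) ∂μ := by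
        refine lintegral_mono_ae ?_
        filter_upwards [hGc] with N hN
        convert RouteSystem.S_le hr hδ hK (N ∈ G) hN
    _ = ENNReal.ofReal r *
        (ENNReal.ofReal (δ * (3 + 2 * K ^ 2)) * ∫⁻ N, N.pairSum A B (fun _ => 1) ∂μ +
          ENNReal.ofReal (2 * δ / r ^ 2) *
            ∫⁻ N, N.pairSum A B (fun t => ENNReal.ofReal (t ^ 2)) ∂μ +
          ∫⁻ N, (if N ∈ G then ENNReal.ofReal δ⁻¹ else 0) *
            N.pairSum A B (fun _ => 1) ∂μ) := by
        have m1 := hn.const_mul (ENNReal.ofReal (δ * (3 + 2 * K ^ 2)))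
        have m2 := hQ.const_mul (ENNReal.ofReal (2 * δ / r ^ 2))
        have m3 : Measurable fun N : RouteSystem =>
            ENNReal.ofReal (δ * (3 + 2 * K ^ 2)) * N.pairSum A B (fun _ => 1) +
              ENNReal.ofReal (2 * δ / r ^ 2) *
                N.pairSum A B (fun t => ENNReal.ofReal (t ^ 2)) := m1.add m2
        rw [lintegral_const_mul' _ _ ENNReal.ofReal_ne_top, lintegral_add_left m3,
          lintegral_add_left m1, lintegral_const_mul _ hn, lintegral_const_mul _ hQ]
    _ ≤ ENNReal.ofReal r * (ENNReal.ofReal δ * (ENNReal.ofReal (3 + 2 * K ^ 2) * (M + 1)) +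
          ENNReal.ofReal δ * ENNReal.ofReal (2 * C) +
          (ENNReal.ofReal δ * M + ENNReal.ofReal (δ⁻¹ ^ 3) * μ G)) := by
        rw [ENNReal.ofReal_mul hδ.le, mul_assoc (ENNReal.ofReal δ)]
        gcongr
    _ = _ := by ring

/-- The first variable is finite and does not depend on `z`, the second has a law independent of `z`
by stationarity, and the third is handled by Markov's inequality. -/
theorem tendsto_measure_union (h : IsShapeLaw μ) [IsProbabilityMeasure μ] {A B : Set Plane}
    (hA : MeasurableSet A) (hB : MeasurableSet B) (hAb : Bornology.IsBounded A)
    (hBb : Bornology.IsBounded B) {c : Plane → ℝ}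
    (hint : ∀ z, Integrable (fun N => |(N.markerDist 0 z).toReal - c z|) μ)
    (hc : ∀ η : ℝ, 0 < η → ∃ R : ℝ, ∀ z : Plane, R ≤ ‖z‖ →
      ∫ N, |(N.markerDist 0 z).toReal - c z| ∂μ ≤ η * ‖z‖) {δ : ℝ} (hδ : 0 < δ) :
    Tendsto (fun z : Plane => μ ({N | ENNReal.ofReal (δ * ‖z‖) < N.supDist A (N.marker 0)} ∪
      {N | ENNReal.ofReal (δ * ‖z‖) < N.supDist (N.marker z) (z +ᵥ B)} ∪
      {N | δ * ‖z‖ < |(N.markerDist 0 z).toReal - c z|}))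
      (Bornology.cobounded Plane) (𝓝 0) := by
  have hr : Tendsto (fun z : Plane => δ * ‖z‖) (Bornology.cobounded Plane) atTop :=
    tendsto_norm_cobounded_atTop.const_mul_atTop hδ
  have t1 := (tendsto_measure_ofReal_lt (μ := μ)
    (RouteSystem.measurable_supDist_marker_right hA 0) fun N =>
      RouteSystem.supDist_ne_top (N.locallyFinite A hAb) (N.finite_points_inter_marker 0)).comp hr
  have t2 := (tendsto_measure_ofReal_lt (μ := μ)
    (RouteSystem.measurable_supDist_marker_left 0 hB) fun N =>
      RouteSystem.supDist_ne_top (N.finite_points_inter_marker 0) (N.locallyFinite B hBb)).comp hr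
  have t3 : Tendsto (fun z : Plane => μ {N | δ * ‖z‖ < |(N.markerDist 0 z).toReal - c z|})
      (Bornology.cobounded Plane) (𝓝 0) := by
    rw [ENNReal.tendsto_nhds_zero]
    intro ε hε
    obtain ⟨η, -, hη0, hηε⟩ := ENNReal.lt_iff_exists_real_btwn.1 hε
    have hη : 0 < η := by simpa using hη0
    obtain ⟨R, hR⟩ := hc (η * δ) (by positivity)
    filter_upwards [tendsto_norm_cobounded_atTop.eventually_ge_atTop R,
      tendsto_norm_cobounded_atTop.eventually_gt_atTop 0] with z hz hz0
    refine le_trans ?_ hηε.le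
    have hmk := mul_meas_ge_le_integral_of_nonneg
      (ae_of_all μ fun N : RouteSystem => abs_nonneg ((N.markerDist 0 z).toReal - c z))
      (hint z) (δ * ‖z‖)
    have h1 : μ.real {N | δ * ‖z‖ ≤ |(N.markerDist 0 z).toReal - c z|} ≤ η := by
      have h2 := hmk.trans (hR z hz)
      have h3 : 0 < δ * ‖z‖ := by positivity
      exact le_of_mul_le_mul_left (h2.trans_eq (by ring)) h3
    refine (measure_mono fun N hN => ?_).trans
      ((ENNReal.le_ofReal_iff_toReal_le (measure_ne_top _ _) hη.le).2 h1)
    simp only [Set.mem_ofPred_eq] at hN ⊢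
    exact hN.le
  have t := (t1.add t2).add t3
  simp only [add_zero] at t
  refine tendsto_of_tendsto_of_tendsto_of_le_of_le tendsto_const_nhds t (fun z => zero_le)
    fun z => ?_
  refine (measure_union_le _ _).trans (add_le_add ((measure_union_le _ _).trans ?_) le_rfl)
  rw [h.measure_supDist_marker_left hB z]
  rfl

/-- A centring which works for the marker distances works for all pairs of points. -/
theorem tendsto_lintegral_S_div (h : IsShapeLaw μ) [IsProbabilityMeasure μ] {A B : Set Plane}
    (hA : MeasurableSet A) (hB : MeasurableSet B) (hAb : Bornology.IsBounded A)
    (hBb : Bornology.IsBounded B) {c : Plane → ℝ} {K : ℝ} (hK : ∀ z, |c z| ≤ K * ‖z‖)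
    (hint : ∀ z, Integrable (fun N => |(N.markerDist 0 z).toReal - c z|) μ)
    (hc : ∀ η : ℝ, 0 < η → ∃ R : ℝ, ∀ z : Plane, R ≤ ‖z‖ →
      ∫ N, |(N.markerDist 0 z).toReal - c z| ∂μ ≤ η * ‖z‖) :
    Tendsto (fun z : Plane => (∫⁻ N, N.S A (z +ᵥ B) (c z) ∂μ) / ENNReal.ofReal ‖z‖)
      (Bornology.cobounded Plane) (𝓝 0) := by
  obtain ⟨M, hM, hMb⟩ := h.exists_lintegral_pairSum_one_sq_le hA hB hAb hBb
  obtain ⟨C, hC, hCb⟩ := h.sq_growth A B hA hB hAb hBb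
  set L : ℝ≥0∞ := ENNReal.ofReal (3 + 2 * K ^ 2) * (M + 1) + ENNReal.ofReal (2 * C) + M with hL
  have hLt : L ≠ ∞ := by
    simp only [hL]
    exact ENNReal.add_ne_top.2 ⟨ENNReal.add_ne_top.2 ⟨ENNReal.mul_ne_top ENNReal.ofReal_ne_top
      (ENNReal.add_ne_top.2 ⟨hM, ENNReal.one_ne_top⟩), ENNReal.ofReal_ne_top⟩, hM⟩
  rw [ENNReal.tendsto_nhds_zero]
  intro ε hε
  -- `L` does not involve `δ`, so `δ` is fixed first; only then is `z` sent to infinity to absorb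
  -- `δ⁻¹ ^ 3`.
  obtain ⟨δ, hδ, hδL⟩ : ∃ δ : ℝ, 0 < δ ∧ ENNReal.ofReal δ * L ≤ ε / 2 := by
    have hlim : Tendsto (fun δ : ℝ => ENNReal.ofReal δ * L) (𝓝[>] 0) (𝓝 0) := by
      have : Tendsto (fun δ : ℝ => ENNReal.ofReal δ * L) (𝓝 0) (𝓝 (ENNReal.ofReal 0 * L)) :=
        ENNReal.Tendsto.mul_const (ENNReal.tendsto_ofReal tendsto_id) (Or.inr hLt)
      simp only [ENNReal.ofReal_zero, zero_mul] at this
      exact this.mono_left nhdsWithin_le_nhds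
    obtain ⟨δ, h1, h2⟩ := ((ENNReal.tendsto_nhds_zero.1 hlim (ε / 2)
      (ENNReal.half_pos hε.ne')).and self_mem_nhdsWithin).exists
    exact ⟨δ, h2, h1⟩
  have hGlim := ENNReal.Tendsto.const_mul (a := ENNReal.ofReal (δ⁻¹ ^ 3))
    (h.tendsto_measure_union hA hB hAb hBb hint hc hδ) (Or.inr ENNReal.ofReal_ne_top)
  rw [mul_zero] at hGlim
  filter_upwards [ENNReal.tendsto_nhds_zero.1 hGlim (ε / 2) (ENNReal.half_pos hε.ne'),
    tendsto_norm_cobounded_atTop.eventually_ge_atTop 1] with z hz hz1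
  have hz0 : 0 < ‖z‖ := by linarith
  refine (lintegral_S_div_le hA (measurableSet_vadd hB z) (hMb z) hz0 (C := C) ?_ hδ (hK z)
    (G := {N | ENNReal.ofReal (δ * ‖z‖) < N.supDist A (N.marker 0)} ∪
      {N | ENNReal.ofReal (δ * ‖z‖) < N.supDist (N.marker z) (z +ᵥ B)} ∪
      {N | δ * ‖z‖ < |(N.markerDist 0 z).toReal - c z|}) ?_ ?_).trans ?_
  · have := hCb z
    rwa [max_eq_right (one_le_pow₀ hz1)] at this
  · refine ((measurableSet_lt measurable_const
      (RouteSystem.measurable_supDist_marker_right hA 0)).union (measurableSet_lt measurable_const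
        (measurable_supDist_marker_left_translate hB z))).union
      (measurableSet_lt measurable_const ?_)
    exact ((RouteSystem.measurable_markerDist 0 z).ennreal_toReal.sub measurable_const).abs
  · filter_upwards [h.ae_nonempty_marker 0, h.ae_nonempty_marker z] with N h0 hz' hN
    simp only [Set.mem_union, Set.mem_ofPred_eq, not_or, not_lt] at hN
    exact RouteSystem.abs_d_sub_markerDist_le (by positivity) h0 hz' hN.1.1 hN.1.2 hN.2
  · calc _ ≤ ε / 2 + ε / 2 := add_le_add hδL hz
      _ = ε := ENNReal.add_halves ε

end IsShapeLaw

/-! ### Polar coordinates and the shape theorem. -/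

/-- The unit vector with angle `θ`. -/
noncomputable def unitVec (θ : ℝ) : Plane := !₂[Real.cos θ, Real.sin θ]

theorem norm_unitVec (θ : ℝ) : ‖unitVec θ‖ = 1 := by
  rw [EuclideanSpace.norm_eq, Real.sqrt_eq_one]
  simp [unitVec]

theorem norm_smul_unitVec_polarAngle (z : Plane) : ‖z‖ • unitVec (polarAngle z) = z := by
  have hn : ‖z‖ = ‖(⟨z 0, z 1⟩ : ℂ)‖ := by
    rw [EuclideanSpace.norm_eq, Complex.norm_def, Complex.normSq_mk]
    congr 1
    simp [sq]
  ext i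
  fin_cases i
  · simp [unitVec, polarAngle, hn, Complex.norm_mul_cos_arg]
  · simp [unitVec, polarAngle, hn, Complex.norm_mul_sin_arg]

theorem norm_unitVec_sub_le (θ φ : ℝ) : ‖unitVec θ - unitVec φ‖ ≤ 2 * |θ - φ| := by
  rw [EuclideanSpace.norm_eq]
  refine Real.sqrt_le_iff.2 ⟨by positivity, ?_⟩
  have h1 := sq_le_sq' (by linarith [abs_nonneg (θ - φ), neg_abs_le (Real.cos θ - Real.cos φ),
    Real.abs_cos_sub_cos_le θ φ]) (abs_le.1 (Real.abs_cos_sub_cos_le θ φ)).2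
  have h2 := sq_le_sq' (by linarith [abs_nonneg (θ - φ), neg_abs_le (Real.sin θ - Real.sin φ),
    Real.abs_sin_sub_sin_le θ φ]) (abs_le.1 (Real.abs_sin_sub_sin_le θ φ)).2
  simp only [unitVec, Fin.sum_univ_two, PiLp.sub_apply, Real.norm_eq_abs, sq_abs]
  simp only [Matrix.cons_val_zero, Matrix.cons_val_one]
  nlinarith [sq_nonneg |θ - φ|]

theorem theorem1 {Ω : Type*} [MeasurableSpace Ω] (P : Measure Ω) [IsProbabilityMeasure P]
    (X : Ω → RouteSystem) (hX : Measurable X)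
    (hPoisson : IsRateOnePoisson P X) (hErgodic : IsInvariantErgodic P X)
    (hL2 : L2GrowthBound P X) :
    ∃ ρ : ℝ → ℝ, Function.Periodic ρ (2 * Real.pi) ∧ (∀ θ, 0 ≤ ρ θ) ∧
      HasL1Shape P X ρ ∧ ∃ K : ℝ≥0, LipschitzWith K ρ := by
  have hlaw := isShapeLaw_map hX hPoisson hErgodic hL2
  have : IsProbabilityMeasure (P.map X) := Measure.isProbabilityMeasure_map hX.aemeasurable
  obtain ⟨C, hY⟩ := hlaw.exists_isErgodicSubadditive
  have hC := hY.const_nonneg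
  -- Passing through the unit vector gives periodicity and the Lipschitz bound on all of `ℝ`, with
  -- no trouble at the cut of `polarAngle`.
  refine ⟨fun θ => hY.rate (unitVec θ), fun θ => ?_, fun θ => hY.rate_nonneg _, ?_,
    (C * 2).toNNReal, LipschitzWith.of_dist_le_mul fun θ φ => ?_⟩
  · simp [unitVec]
  · intro A B hA hB hAb hBb
    refine (hlaw.tendsto_lintegral_S_div hA hB hAb hBb
      (c := fun z => ‖z‖ * hY.rate (unitVec (polarAngle z))) (K := C * 2) (fun z => ?_)
      (fun z => ((hY.integrable 0 z).sub (integrable_const _)).abs) fun η hη => ?_).congr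
        fun z => ?_
    · have h1 := hY.rate_nonneg (unitVec (polarAngle z))
      have h2 := hY.rate_le (unitVec (polarAngle z))
      rw [norm_unitVec] at h2
      rw [abs_of_nonneg (by positivity), mul_comm]
      gcongr
      linarith
    · obtain ⟨R, hR⟩ := hY.exists_forall_integral_abs_sub_le hη
      refine ⟨R, fun z hz => ?_⟩
      have := hR ‖z‖ hz (unitVec (polarAngle z)) (norm_unitVec _)
      rwa [norm_smul_unitVec_polarAngle] at this
    · congr 1
      exact lintegral_map (RouteSystem.measurable_pairSum hA (measurableSet_vadd hB z)
        (by fun_prop)) hX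
  · rw [Real.dist_eq, Real.dist_eq]
    calc _ ≤ C * ‖unitVec θ - unitVec φ‖ := hY.abs_rate_sub_rate_le _ _
      _ ≤ C * (2 * |θ - φ|) := by
        gcongr
        exact norm_unitVec_sub_le θ φ
      _ = _ := by rw [Real.coe_toNNReal _ (by positivity)]; ring
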